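/- Let $\mathbb F$ be a finite field with $q$ elements, $A=\mathbb F[T]$, $K=\mathbb F(T)$, $K_\infty=\mathbb F((T^{-1}))$ the completion of $K$ at infinity, and $C_\infty$ the completed algebraic closure of $K_\infty$, with absolute value normalized by $|T|=q$. Put $\log x=\log_q|x|$ for $0\neq x\in C_\infty$ and $\log 0=-\infty$. For an $A$-lattice $\Lambda\subset C_\infty$ of rank $r$, write $e^\Lambda(z)=z\prod_{0\ne\lambda\in\Lambda}(1-z/\lambda)$; for $0\neq a\in A$ of degree $d$ let $\phi_a^\Lambda(X)=aX+\sum_{1\le i\le rd}{}_a\ell_i X^{q^i}\in C_\infty[X]$ be the polynomial with $e^\Lambda(az)=\phi_a^\Lambda(e^\Lambda(z))$ for all $z\in C_\infty$, and let $\Delta_a(\Lambda)$ be its coefficient at $X^{q^{rd}}$. The canonical discriminant $\Delta(\Lambda)$ is the unique element of $C_\infty$ with $\Delta_a(\Lambda)=\operatorname{sgn}(a)\,\Delta(\Lambda)^{(q^{rd}-1)/(q^r-1)}$ for all $0\ne a\in A$, where $d=\deg a$ and $\operatorname{sgn}(a)$ is the leading coefficient of $a$. For $\omega\in C_\infty$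 let $|\omega|_i=\inf_{x\in K_\infty}|\omega-x|$, and for an integer $\ell\ge 0$ let $\mathbf F_\ell=\{\omega\in C_\infty\smallsetminus K_\infty : |\omega|=|\omega|_i=q^\ell\}$. Let $\omega\in\mathbf F_\ell$, $Y=A^2$ and $\Lambda=Y_{\boldsymbol\omega}=A\omega+A$, where $\boldsymbol\omega=(\omega,1)$. Then the product defining $e^\Lambda(z)$ converges for every $z\in C_\infty$, the canonical discriminant $\Delta(\omega)=\Delta(\Lambda)$ exists and is unique, and $$\log\Delta(\omega)=q^2+q-q^{\ell+1}.$$ Moreover, let $a_1,a_2,n\in A$ with $n\neq0$ and $\deg a_1,\deg a_2<\deg n$ (where $\deg 0=-\infty$), let $0\ne\mathbf u=n^{-1}(a_1,a_2)\in K^2$, $d_1=\deg a_1$, $u=\mathbf u\boldsymbol\omega=n^{-1}(a_1\omega+a_2)$ and $d_{\mathbf u}^Y(\omega)=e^\Lambda(u)$. Then $$\log d_{\mathbf u}^Y(\omega)=\begin{cases}\dfrac{q}{q-1}\left(q^{\ell+d_1-\deg n}-1\right),&\text{if }\log u\ge0,\\[1ex] \log u,&\text{if }\log u<0.\end{cases}$$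 (If $\log u\geq 0$, then necessarily $a_1\ne0$, so $d_1$ is a natural number in the first case.) -/

import Mathlib

open Polynomial
open scoped NNReal WithZero

noncomputable section

namespace DrinfeldFT

variable (F : Type*) [Field F]

/-! ### The fields `K`, `K_∞` and `C_∞` for `A = 𝔽[T]` -/

/-- The completion `K_∞ = 𝔽((T⁻¹))` of `K = 𝔽(T)` at the place at infinity. -/
def KInf : Type _ := @RatFunc.CompletionAtInfty F _ (Classical.decEq _)

instance : Field (KInf F) :=
  inferInstanceAs (Field (@RatFunc.CompletionAtInfty F _ (Classical.decEq _)))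

instance : Algebra (RatFunc F) (KInf F) :=
  inferInstanceAs (Algebra (RatFunc F) (@RatFunc.CompletionAtInfty F _ (Classical.decEq _)))

instance : Valued (KInf F) ℤᵐ⁰ :=
  inferInstanceAs (Valued (@RatFunc.CompletionAtInfty F _ (Classical.decEq _)) ℤᵐ⁰)

instance : CompleteSpace (KInf F) :=
  @UniformSpace.Completion.completeSpace (RatFunc F)
    (@RatFunc.inftyValued F _ (Classical.decEq _)).toUniformSpace

/-- On `K`, the valuation of `K_∞` is the valuation at infinity. -/
theorem valued_algebraMap (x : RatFunc F) :
    (Valued.v (algebraMap (RatFunc F) (KInf F) x) : ℤᵐ⁰) =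
      @RatFunc.inftyValuation F _ (Classical.decEq _) x :=
  @Valued.extensionValuation_apply_coe (RatFunc F) _ _ _
    (@RatFunc.inftyValued F _ (Classical.decEq _)) x

theorem valued_X : (Valued.v (algebraMap (RatFunc F) (KInf F) RatFunc.X) : ℤᵐ⁰) =
    WithZero.exp (1 : ℤ) := by
  rw [valued_algebraMap, RatFunc.inftyValuation.X]

variable [Finite F]

theorem one_lt_card : (1 : ℝ≥0) < (Nat.card F : ℝ≥0) := by
  exact_mod_cast Finite.one_lt_card

/-- The real absolute value attached to the valuation at infinity: `exp m` is sent to `q ^ m`. -/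
instance : Valuation.RankOne (Valued.v : Valuation (KInf F) ℤᵐ⁰) where
  hom' := (WithZeroMulInt.toNNReal (one_lt_card F).ne_zero).comp
    MonoidWithZeroHom.ValueGroup₀.embedding
  strictMono' := (WithZeroMulInt.toNNReal_strictMono (one_lt_card F)).comp
    MonoidWithZeroHom.ValueGroup₀.embedding_strictMono
  exists_val_nontrivial :=
    ⟨algebraMap (RatFunc F) (KInf F) RatFunc.X, by rw [valued_X]; simp, by
      rw [valued_X, ← WithZero.exp_zero, Ne, WithZero.exp_inj]; simp⟩

instance : NontriviallyNormedField (KInf F) := Valued.toNontriviallyNormedField (KInf F) ℤᵐ⁰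

instance : IsUltrametricDist (KInf F) :=
  ⟨fun x y z => by
    have h := (Valued.v : Valuation (KInf F) ℤᵐ⁰).norm_add_le (x - y) (y - z)
    rw [sub_add_sub_cancel] at h
    exact h⟩

theorem norm_eq (x : KInf F) :
    ‖x‖ = WithZeroMulInt.toNNReal (one_lt_card F).ne_zero (Valued.v x : ℤᵐ⁰) := by
  change ((WithZeroMulInt.toNNReal (one_lt_card F).ne_zero
    (MonoidWithZeroHom.ValueGroup₀.embedding (Valued.v.restrict x)) : ℝ≥0) : ℝ) = _
  rw [Valuation.embedding_restrict]

/-- The absolute value of `K_∞` is normalized by `|T| = q`. -/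
theorem norm_X : ‖algebraMap (RatFunc F) (KInf F) RatFunc.X‖ = Nat.card F := by
  rw [norm_eq, valued_X, WithZeroMulInt.toNNReal_neg_apply _ WithZero.exp_ne_zero]
  simp [WithZero.exp]

/-- An algebraic closure of `K_∞`. -/
abbrev KInfAlg : Type _ := AlgebraicClosure (KInf F)

instance : NontriviallyNormedField (KInfAlg F) :=
  spectralNorm.nontriviallyNormedField (KInf F) (KInfAlg F)

instance : NormedAlgebra (KInf F) (KInfAlg F) :=
  spectralNorm.normedAlgebra (KInf F) (KInfAlg F)

instance : UniformContinuousConstSMul (KInf F) (KInfAlg F) :=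
  uniformContinuousConstSMul_of_continuousConstSMul (KInf F) (KInfAlg F)

/-- `C_∞`: the completed algebraic closure of `K_∞`. -/
def CInf : Type _ := UniformSpace.Completion (KInfAlg F)

instance : NormedField (CInf F) :=
  inferInstanceAs (NormedField (UniformSpace.Completion (KInfAlg F)))

instance : CompleteSpace (CInf F) :=
  inferInstanceAs (CompleteSpace (UniformSpace.Completion (KInfAlg F)))

instance : NormedAlgebra (KInf F) (CInf F) :=
  inferInstanceAs (NormedAlgebra (KInf F) (UniformSpace.Completion (KInfAlg F)))

instance : IsUltrametricDist (CInf F) := IsUltrametricDist.of_normedAlgebra (KInf F)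

instance : Algebra (RatFunc F) (CInf F) :=
  ((algebraMap (KInf F) (CInf F)).comp (algebraMap (RatFunc F) (KInf F))).toAlgebra

instance : Algebra F[X] (CInf F) :=
  ((algebraMap (RatFunc F) (CInf F)).comp (algebraMap F[X] (RatFunc F))).toAlgebra

instance : IsScalarTower (RatFunc F) (KInf F) (CInf F) := .of_algebraMap_eq fun _ => rfl

instance : IsScalarTower F[X] (RatFunc F) (CInf F) := .of_algebraMap_eq fun _ => rfl

variable {F}

/-- `log x = log_q |x|` for `x ≠ 0`, and `log 0 = -∞`. -/
def logq (x : CInf F) : EReal := by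
  classical exact if x = 0 then ⊥ else ((Real.logb (Nat.card F) ‖x‖ : ℝ) : EReal)

/-! ### Lattices, exponential functions and division forms -/

/-- The map `i_ω : K ^ r → C_∞`, `v ↦ vω = ∑ i, v_i ω_i`. -/
def embed {r : ℕ} (ω : Fin r → CInf F) : (Fin r → RatFunc F) →ₗ[F[X]] CInf F :=
  (Fintype.linearCombination (RatFunc F) ω).restrictScalars F[X]

/-- The lattice `Y_ω = i_ω(Y)` in `C_∞`. -/
def latticeOf {r : ℕ} (Y : Submodule F[X] (Fin r → RatFunc F)) (ω : Fin r → CInf F) :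
    Submodule F[X] (CInf F) :=
  Y.map (embed ω)

variable (F) in
/-- The lattice `A ^ r` in `K ^ r`. -/
def stdLattice (r : ℕ) : Submodule F[X] (Fin r → RatFunc F) :=
  Submodule.pi Set.univ fun _ => LinearMap.range (Algebra.linearMap F[X] (RatFunc F))

/-- The exponential function `e^Λ(z) = z ∏' (1 - z / l)`, over the nonzero elements `l` of `Λ`. -/
def expLattice (Λ : Submodule F[X] (CInf F)) (z : CInf F) : CInf F :=
  z * ∏' l : {l : CInf F // l ∈ Λ ∧ l ≠ 0}, (1 - z / (l : CInf F))

/-- The division form `d_u^Y(ω) = e^{Y_ω}(uω)`. -/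
def divisionForm {r : ℕ} (Y : Submodule F[X] (Fin r → RatFunc F)) (u : Fin r → RatFunc F)
    (ω : Fin r → CInf F) : CInf F :=
  expLattice (latticeOf Y ω) (embed ω u)

/-! ### Drinfeld modules and the canonical discriminant -/

/-- `φ` is the polynomial `φ_a^Λ = a X + ∑_{1 ≤ i ≤ r deg a} c_i X^(q^i)`, `r` the rank of `Λ`,
with `e^Λ(a z) = φ_a^Λ(e^Λ(z))` for all `z`. -/
structure IsDrinfeldPolynomial (Λ : Submodule F[X] (CInf F)) (a : F[X]) (φ : (CInf F)[X]) :
    Prop where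
  exists_coeff : ∃ c : ℕ → CInf F, φ = C (algebraMap F[X] (CInf F) a) * X +
    ∑ i ∈ Finset.Icc 1 (Module.finrank F[X] Λ * a.natDegree), C (c i) * X ^ (Nat.card F ^ i)
  exp_smul : ∀ z : CInf F, expLattice Λ (a • z) = φ.eval (expLattice Λ z)

/-- `Δ` is the canonical discriminant of `Λ`: for each nonzero `a ∈ A` of degree `d`, the
coefficient `Δ_a(Λ)` of `X^(q^(rd))` in `φ_a^Λ` is `sgn(a) Δ ^ ((q^(rd) - 1) / (q^r - 1))`,
where `sgn(a)` is the leading coefficient of `a` and `r` is the rank of `Λ`. -/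
def IsCanonicalDiscriminant (Λ : Submodule F[X] (CInf F)) (Δ : CInf F) : Prop :=
  ∀ a : F[X], a ≠ 0 → ∃ φ : (CInf F)[X], IsDrinfeldPolynomial Λ a φ ∧
    φ.coeff (Nat.card F ^ (Module.finrank F[X] Λ * a.natDegree)) =
      algebraMap F[X] (CInf F) (C a.leadingCoeff) *
        Δ ^ ((Nat.card F ^ (Module.finrank F[X] Λ * a.natDegree) - 1) /
          (Nat.card F ^ Module.finrank F[X] Λ - 1))

/-! ### The fundamental domain in rank two -/

/-- `|ω|_i`, the distance from `ω` to `K_∞`. -/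
def imagNorm (ω : CInf F) : ℝ := ⨅ x : KInf F, ‖ω - algebraMap (KInf F) (CInf F) x‖

variable (F) in
/-- The part `𝐅_ℓ = {ω ∈ C_∞ ∖ K_∞ : |ω| = |ω|_i = q ^ ℓ}` of the fundamental domain. -/
def fundDomainPart (ℓ : ℕ) : Set (CInf F) :=
  {ω | ω ∉ Set.range (algebraMap (KInf F) (CInf F)) ∧
    ‖ω‖ = (Nat.card F : ℝ) ^ ℓ ∧ imagNorm ω = (Nat.card F : ℝ) ^ ℓ}

end DrinfeldFT

end

open Polynomial
open scoped NNReal WithZero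

noncomputable section

/-! Everything rests on one orthogonality fact: for `ω` in `𝐅_ℓ`, `|xω + y| = max(|x| q^ℓ, |y|)` for
all `x, y ∈ K_∞` (`norm_mul_add_eq_max`). It makes `Λ = Aω + A` discrete of rank 2. Since factors `1
- z/l` with `|l| > |z|` have norm 1, `|e^Λ(z)|` is a finite product over the lattice points in the
ball of radius `|z|`.

If `u = xω + y` with `|x|, |y| < 1`, then `|u - l| ≥ |l|` for every `l ∈ Λ`, so each factor with
`|l| ≤ |u|` has norm exactly `|u|/|l|`. For `|u| < 1` there is no such nonzero `l`, and `|e^Λ(u)| =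
|u|`. For `|u| = q^k` with `k < ℓ` the relevant `l` are the nonzero polynomials of degree at most
`k`, and counting them by degree gives `log e^Λ(u) = q + ... + q^k`.

For the discriminant, adjoining one vector `w` to an `F`-space `V` changes its exponential by `e ↦ e
- e^q / e(w)^(q-1)` (`IsDiscreteSet.setExp_adjoin`). Going from `Λ` to `T⁻¹Λ` takes two such steps,
by `1/T` and then `ω/T`. Together with `e^Λ(Tz) = T e^{T⁻¹Λ}(z)` this produces `φ_T` and expresses
its top coefficient `Δ` through values of exponentials at `T`-division points, whose norms are known
from the first computation (`exists_expLattice_X_smul`). Writing `a` in Horner form gives `φ_a` and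
its leading coefficient (`exists_coeff_of_exp`); the case `a = T` forces uniqueness. -/

namespace DrinfeldFT

/-! ### Exponentials of finite `F`-vector spaces. -/

section FiniteExp

open Classical in
/-- The polynomial function `z ∏ (1 - z / v)`, over the nonzero elements `v` of a finite set. -/
def finsetExp {L : Type*} [Field L] (S : Finset L) (z : L) : L :=
  z * ∏ v ∈ S.erase 0, (1 - z / v)

variable {L : Type*} [Field L]

open Classical in
theorem finsetExp_eq_prod_sub {S : Finset L} (h0 : 0 ∈ S) (z : L) :
    finsetExp S z = (∏ v ∈ S, (z - v)) * ∏ v ∈ S.erase 0, (-v⁻¹) := by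
  rw [finsetExp, ← Finset.mul_prod_erase S _ h0, sub_zero, mul_assoc, ← Finset.prod_mul_distrib]
  congr 1
  refine Finset.prod_congr rfl fun v hv => ?_
  have := Finset.ne_of_mem_erase hv
  field_simp
  ring

theorem finsetExp_ne_zero {S : Finset L} (h0 : 0 ∈ S) {z : L} (hz : z ∉ S) :
    finsetExp S z ≠ 0 := by
  classical
  rw [finsetExp_eq_prod_sub h0]
  refine mul_ne_zero (Finset.prod_ne_zero_iff.2 fun v hv => sub_ne_zero.2 ?_)
    (Finset.prod_ne_zero_iff.2 fun v hv => by simpa using Finset.ne_of_mem_erase hv)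
  rintro rfl
  exact hz hv

/-- With `p = ∏ (X - v)`, the polynomial `p(X + z) - p(X) - p(z)` has degree below `|S|`, because
the monic top terms cancel, yet it vanishes on `S` by translation invariance. Hence it is zero. -/
theorem finsetExp_add {S : Finset L} (h0 : 0 ∈ S) (hadd : ∀ x ∈ S, ∀ y ∈ S, x + y ∈ S)
    (y z : L) : finsetExp S (y + z) = finsetExp S y + finsetExp S z := by
  classical
  simp only [finsetExp_eq_prod_sub h0]
  rw [← add_mul]
  congr 1
  set p : L[X] := ∏ v ∈ S, (X - C v) with hp
  have hev : ∀ x, p.eval x = ∏ v ∈ S, (x - v) := fun x => by simp [hp, eval_prod]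
  have hmonic : p.Monic := monic_prod_of_monic _ _ fun v _ => monic_X_sub_C v
  have hnat : p.natDegree = S.card := by
    rw [hp, natDegree_prod_of_monic _ _ fun v _ => monic_X_sub_C v]
    simp
  have hcard : 0 < S.card := Finset.card_pos.2 ⟨0, h0⟩
  have hzero : ∀ v ∈ S, p.eval v = 0 := fun v hv => by
    rw [hev]
    exact Finset.prod_eq_zero hv (sub_self v)
  have htrans : ∀ v ∈ S, p.eval (v + z) = p.eval z := fun v hv => by
    rw [hev, hev]
    have himg : S.image (v + ·) = S := Finset.eq_of_subset_of_card_le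
      (Finset.image_subset_iff.2 fun x hx => hadd v hv x hx)
      (Finset.card_image_of_injective _ (add_right_injective v)).ge
    conv_lhs => rw [← himg]
    rw [Finset.prod_image fun a _ b _ h => add_right_injective v h]
    exact Finset.prod_congr rfl fun x _ => by ring
  have hlt : (p.comp (X + C z) - p - C (p.eval z)).degree < S.card := by
    have hm2 : (p.comp (X + C z)).Monic := hmonic.comp_X_add_C z
    have hd : (p.comp (X + C z)).degree = p.degree := by
      rw [degree_eq_natDegree hm2.ne_zero, degree_eq_natDegree hmonic.ne_zero, natDegree_comp,
        natDegree_X_add_C, mul_one]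
    have hpd : p.degree = S.card := by rw [degree_eq_natDegree hmonic.ne_zero, hnat]
    refine lt_of_le_of_lt (degree_sub_le _ _) (max_lt ?_ ?_)
    · rw [← hpd, ← hd]
      exact degree_sub_lt_left hd hm2.ne_zero (by rw [hm2.leadingCoeff, hmonic.leadingCoeff])
    · exact lt_of_le_of_lt degree_C_le (by exact_mod_cast hcard)
  have h := eq_zero_of_degree_lt_of_eval_finset_eq_zero (s := S) hlt fun v hv => by
    simp only [eval_sub, eval_comp, eval_add, eval_X, eval_C, htrans v hv, hzero v hv]
    ring
  have h2 := congrArg (eval y) h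
  simp only [eval_sub, eval_comp, eval_add, eval_X, eval_C, eval_zero, hev] at h2
  linear_combination h2

variable {F : Type*} [Field F] [Algebra F L]

theorem finsetExp_smul {S : Finset L} (hsmul : ∀ α : F, ∀ x ∈ S, α • x ∈ S)
    (α : F) (z : L) : finsetExp S (α • z) = α • finsetExp S z := by
  classical
  rcases eq_or_ne α 0 with rfl | hα
  · simp [finsetExp]
  rw [finsetExp, finsetExp, smul_mul_assoc]
  congr 2
  symm
  refine Finset.prod_bij' (fun v _ => α • v) (fun v _ => α⁻¹ • v) ?_ ?_ ?_ ?_ ?_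
  · intro v hv
    rw [Finset.mem_erase] at hv ⊢
    exact ⟨smul_ne_zero hα hv.1, hsmul α v hv.2⟩
  · intro v hv
    rw [Finset.mem_erase] at hv ⊢
    exact ⟨smul_ne_zero (inv_ne_zero hα) hv.1, hsmul _ v hv.2⟩
  · intro v _
    exact inv_smul_smul₀ hα v
  · intro v _
    exact smul_inv_smul₀ hα v
  · intro v _
    have : algebraMap F L α ≠ 0 := by simpa using hα
    rw [Algebra.smul_def, Algebra.smul_def, mul_div_mul_left _ _ this]

theorem finsetExp_sub {S : Finset L} (h0 : 0 ∈ S) (hadd : ∀ x ∈ S, ∀ y ∈ S, x + y ∈ S)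
    (y z : L) : finsetExp S (y - z) = finsetExp S y - finsetExp S z := by
  have := finsetExp_add h0 hadd (y - z) z
  rw [sub_add_cancel] at this
  rw [this, add_sub_cancel_right]

/-- The product over the coset `y + S` is `e_S(y - z) / e_S(y)`, which additivity splits. -/
theorem prod_one_sub_div_add {S : Finset L} (h0 : 0 ∈ S) (hadd : ∀ x ∈ S, ∀ y ∈ S, x + y ∈ S)
    (hneg : ∀ x ∈ S, -x ∈ S) {y : L} (hy : y ∉ S) (z : L) :
    ∏ v ∈ S, (1 - z / (y + v)) = 1 - finsetExp S z / finsetExp S y := by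
  classical
  have hE := finsetExp_ne_zero h0 hy
  rw [one_sub_div hE, ← finsetExp_sub h0 hadd, eq_div_iff hE, finsetExp_eq_prod_sub h0,
    finsetExp_eq_prod_sub h0, ← mul_assoc]
  congr 1
  have h : ∏ v ∈ S, (1 - z / (y + v)) = ∏ v ∈ S, (1 - z / (y - v)) := by
    refine Finset.prod_bij' (fun v _ => -v) (fun v _ => -v) hneg hneg ?_ ?_ ?_ <;> simp
  rw [h, ← Finset.prod_mul_distrib]
  refine Finset.prod_congr rfl fun v hv => ?_
  have : y - v ≠ 0 := sub_ne_zero.2 fun h => hy (h ▸ hv)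
  field_simp
  ring

open Classical in
theorem prod_one_sub_div_algebraMap [Fintype F] (t : L) :
    ∏ α ∈ Finset.univ.erase (0 : F), (1 - t / algebraMap F L α) = 1 - t ^ (Fintype.card F - 1) := by
  have h1 : ∏ α : F, (X - C α) = X ^ Fintype.card F - X := by
    have hd := FiniteField.X_pow_card_sub_X_natDegree_eq F (Fintype.one_lt_card (α := F))
    have hr := FiniteField.roots_X_pow_card_sub_X F
    have := prod_multiset_X_sub_C_of_monic_of_roots_card_eq (p := (X ^ Fintype.card F - X : F[X]))
      (monic_X_pow_sub (by rw [degree_X]; exact_mod_cast Fintype.one_lt_card))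
      (by rw [hr, hd]; simp [Finset.card_univ])
    rw [hr] at this
    exact this
  have hq : Fintype.card F = (Fintype.card F - 1) + 1 := (Nat.sub_add_cancel Fintype.card_pos).symm
  have h2 : ∏ α ∈ Finset.univ.erase (0 : F), (X - C α) = X ^ (Fintype.card F - 1) - 1 := by
    rw [← Finset.mul_prod_erase _ _ (Finset.mem_univ (0 : F)), hq, pow_succ'] at h1
    simp only [map_zero, sub_zero] at h1
    refine mul_left_cancel₀ (X_ne_zero (R := F)) (h1.trans ?_)
    ring
  have h3 : ∀ x : L, ∏ α ∈ Finset.univ.erase (0 : F), (x - algebraMap F L α) =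
      x ^ (Fintype.card F - 1) - 1 := fun x => by
    simpa [map_prod] using congrArg (aeval x) h2
  have h4 := h3 0
  rw [zero_pow (Nat.sub_ne_zero_of_lt Fintype.one_lt_card)] at h4
  have h5 : ∏ α ∈ Finset.univ.erase (0 : F), (1 - t / algebraMap F L α) =
      (∏ α ∈ Finset.univ.erase (0 : F), (t - algebraMap F L α)) /
        ∏ α ∈ Finset.univ.erase (0 : F), (0 - algebraMap F L α) := by
    rw [← Finset.prod_div_distrib]
    refine Finset.prod_congr rfl fun α hα => ?_
    have : algebraMap F L α ≠ 0 := by simpa using Finset.ne_of_mem_erase hα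
    field_simp
    ring
  rw [h5, h3, h4]
  ring

/-- Beyond `S`, the new space consists of the cosets `αw + S` with `α ≠ 0`. Each contributes `1 -
t/α` for `t = e_S(z)/e_S(w)`, and these multiply to `1 - t^(q-1)`. -/
theorem finsetExp_adjoin [Finite F] {S S' : Finset L} (h0 : 0 ∈ S)
    (hadd : ∀ x ∈ S, ∀ y ∈ S, x + y ∈ S) (hsmul : ∀ α : F, ∀ x ∈ S, α • x ∈ S) {w : L}
    (hw : w ∉ S) (hS' : ∀ x, x ∈ S' ↔ ∃ α : F, ∃ v ∈ S, x = α • w + v) (z : L) :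
    finsetExp S' z = finsetExp S z -
      finsetExp S z ^ Nat.card F / finsetExp S w ^ (Nat.card F - 1) := by
  classical
  have := Fintype.ofFinite F
  have hneg : ∀ x ∈ S, -x ∈ S := fun x hx => by simpa using hsmul (-1) x hx
  have hsub : ∀ x ∈ S, ∀ y ∈ S, x - y ∈ S := fun x hx y hy => by
    simpa [sub_eq_add_neg] using hadd x hx _ (hneg y hy)
  have hαw : ∀ α : F, α ≠ 0 → α • w ∉ S := fun α hα h => hw (by
    simpa [inv_smul_smul₀ hα] using hsmul α⁻¹ _ h)
  have hS : S'.erase 0 = S.erase 0 ∪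
      (Finset.univ.erase (0 : F) ×ˢ S).image fun p => p.1 • w + p.2 := by
    ext x
    simp only [Finset.mem_erase, Finset.mem_union, Finset.mem_image, Finset.mem_product,
      Finset.mem_univ, hS', Prod.exists]
    constructor
    · rintro ⟨hx, α, v, hv, rfl⟩
      rcases eq_or_ne α 0 with rfl | hα
      · left
        simpa using And.intro (by simpa using hx) hv
      · exact Or.inr ⟨α, v, ⟨⟨hα, trivial⟩, hv⟩, rfl⟩
    · rintro (⟨hx, hv⟩ | ⟨α, v, ⟨⟨hα, -⟩, hv⟩, rfl⟩)
      · exact ⟨hx, 0, x, hv, by simp⟩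
      · refine ⟨fun h => hαw α hα ?_, α, v, hv, rfl⟩
        rw [eq_neg_of_add_eq_zero_left h]
        exact hneg v hv
  have hdisj : Disjoint (S.erase 0)
      ((Finset.univ.erase (0 : F) ×ˢ S).image fun p => p.1 • w + p.2) := by
    rw [Finset.disjoint_left]
    simp only [Finset.mem_erase, Finset.mem_image, Finset.mem_product, Prod.exists]
    rintro x ⟨-, hx⟩ ⟨α, v, ⟨⟨hα, -⟩, hv⟩, rfl⟩
    exact hαw α hα (by simpa using hsub _ hx v hv)
  have hinj : Set.InjOn (fun p : F × L => p.1 • w + p.2)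
      (Finset.univ.erase (0 : F) ×ˢ S : Finset (F × L)) := by
    rintro ⟨α, v⟩ h1 ⟨β, u⟩ h2 h
    simp only [Finset.coe_product, Set.mem_prod, Finset.mem_coe] at h1 h2 h
    have h3 : (α - β) • w = u - v := by rw [sub_smul]; linear_combination h
    have h4 : α - β = 0 := by
      by_contra h5
      exact hαw _ h5 (h3 ▸ hsub _ h2.2 _ h1.2)
    rw [h4, zero_smul] at h3
    rw [sub_eq_zero.1 h4, sub_eq_zero.1 h3.symm]
  have hEw := finsetExp_ne_zero h0 hw
  rw [finsetExp, hS, Finset.prod_union hdisj, Finset.prod_image hinj, Finset.prod_product,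
    ← mul_assoc, ← finsetExp]
  have h6 : ∀ α ∈ Finset.univ.erase (0 : F), ∏ v ∈ S, (1 - z / (α • w + v)) =
      1 - (finsetExp S z / finsetExp S w) / algebraMap F L α := fun α hα => by
    rw [prod_one_sub_div_add h0 hadd hneg (hαw α (Finset.ne_of_mem_erase hα)),
      finsetExp_smul hsmul, Algebra.smul_def, div_div, mul_comm (algebraMap F L α)]
  rw [Finset.prod_congr rfl h6, prod_one_sub_div_algebraMap, Nat.card_eq_fintype_card, div_pow]
  have hq : Fintype.card F = (Fintype.card F - 1) + 1 := (Nat.sub_add_cancel Fintype.card_pos).symm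
  rw [show finsetExp S z ^ Fintype.card F = finsetExp S z * finsetExp S z ^ (Fintype.card F - 1) by
    conv_lhs => rw [hq, pow_succ']]
  ring

end FiniteExp

/-! ### Convergence and norms of infinite products over discrete sets. -/

section InfiniteExp

open Filter Topology

/-- A set is discrete if it has finitely many elements in each ball around `0`. -/
def IsDiscreteSet {L : Type*} [Norm L] (S : Set L) : Prop := ∀ R : ℝ, {x | x ∈ S ∧ ‖x‖ ≤ R}.Finite

/-- The elements of a discrete set in the ball of radius `R`. -/
def IsDiscreteSet.ball {L : Type*} [Norm L] {S : Set L} (hS : IsDiscreteSet S) (R : ℝ) : Finset L :=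
  (hS R).toFinset

theorem IsDiscreteSet.mem_ball {L : Type*} [Norm L] {S : Set L} (hS : IsDiscreteSet S) {R : ℝ}
    {x : L} : x ∈ hS.ball R ↔ x ∈ S ∧ ‖x‖ ≤ R := by
  simp [ball]

theorem IsDiscreteSet.mono {L : Type*} [Norm L] {S S' : Set L} (hS : IsDiscreteSet S)
    (h : S' ⊆ S) : IsDiscreteSet S' :=
  fun R => (hS R).subset fun _ hx => ⟨h hx.1, hx.2⟩

/-- The function `z ∏' (1 - z / l)`, over the nonzero elements `l` of a set. -/
def setExp {L : Type*} [NormedField L] (S : Set L) (z : L) : L :=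
  z * ∏' l : {l : L // l ∈ S ∧ l ≠ 0}, (1 - z / (l : L))

variable {L : Type*} [NormedField L] [IsUltrametricDist L]

theorem norm_eq_one_of_norm_sub_one_lt {x : L} (h : ‖x - 1‖ < 1) : ‖x‖ = 1 := by
  have := IsUltrametricDist.norm_add_eq_max_of_norm_ne_norm (x := x - 1) (y := 1)
    (by rw [norm_one]; exact h.ne)
  rw [sub_add_cancel, norm_one, max_eq_right h.le] at this
  exact this

/-- In an ultrametric field a ball of radius at most 1 around 1 is closed under products, so no
error accumulates with the number of factors. -/
theorem norm_prod_sub_one_le {ι : Type*} {f : ι → L} {ε : ℝ} (h0 : 0 ≤ ε) (h1 : ε ≤ 1)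
    (t : Finset ι) (h : ∀ i ∈ t, ‖f i - 1‖ ≤ ε) : ‖∏ i ∈ t, f i - 1‖ ≤ ε := by
  classical
  induction t using Finset.induction_on with
  | empty => simpa
  | insert a s ha ih =>
    have ha1 := h a (Finset.mem_insert_self a s)
    have hf : ‖f a‖ ≤ 1 := by
      have := IsUltrametricDist.norm_add_le_max (f a - 1) 1
      rw [sub_add_cancel, norm_one] at this
      exact this.trans (max_le (ha1.trans h1) le_rfl)
    rw [Finset.prod_insert ha, show f a * ∏ i ∈ s, f i - 1 = f a * (∏ i ∈ s, f i - 1) + (f a - 1) by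
      ring]
    refine (IsUltrametricDist.norm_add_le_max _ _).trans (max_le ?_ ha1)
    rw [norm_mul]
    exact (mul_le_of_le_one_left (norm_nonneg _) hf).trans
      (ih fun i hi => h i (Finset.mem_insert_of_mem hi))

theorem norm_one_sub_div_eq_one {z l : L} (h : ‖z‖ < ‖l‖) : ‖1 - z / l‖ = 1 := by
  refine norm_eq_one_of_norm_sub_one_lt ?_
  rw [sub_sub_cancel_left, norm_neg, norm_div]
  exact (div_lt_one ((norm_nonneg z).trans_lt h)).2 h

variable {S : Set L} (hS : IsDiscreteSet S)
include hS

open Classical in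
/-- The nonzero elements of a discrete set in the ball of radius `R`. -/
def IsDiscreteSet.ballSubtype (R : ℝ) : Finset {l : L // l ∈ S ∧ l ≠ 0} :=
  (hS.ball R).subtype _

omit [IsUltrametricDist L] in
theorem IsDiscreteSet.mem_ballSubtype {R : ℝ} {l : {l : L // l ∈ S ∧ l ≠ 0}} :
    l ∈ hS.ballSubtype R ↔ ‖(l : L)‖ ≤ R := by
  simp [ballSubtype, hS.mem_ball, l.2.1]

omit [IsUltrametricDist L] in
open Classical in
theorem IsDiscreteSet.prod_ballSubtype {M : Type*} [CommMonoid M] (R : ℝ) (f : L → M) :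
    ∏ l ∈ hS.ballSubtype R, f l = ∏ l ∈ (hS.ball R).erase 0, f l := by
  rw [ballSubtype, Finset.prod_subtype_eq_prod_filter]
  refine Finset.prod_congr ?_ fun _ _ => rfl
  ext x
  simp only [Finset.mem_filter, hS.mem_ball, Finset.mem_erase]
  tauto

omit [IsUltrametricDist L] in
theorem IsDiscreteSet.tendsto_ballSubtype : Tendsto hS.ballSubtype atTop atTop := by
  refine tendsto_atTop_finset_of_monotone (fun R R' h l hl => ?_) fun l => ⟨‖(l : L)‖, ?_⟩
  · rw [hS.mem_ballSubtype] at hl ⊢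
    exact hl.trans h
  · rw [hS.mem_ballSubtype]

theorem IsDiscreteSet.norm_prod_eq (z : L) {s : Finset {l : L // l ∈ S ∧ l ≠ 0}}
    (hs : hS.ballSubtype ‖z‖ ⊆ s) :
    ‖∏ l ∈ s, (1 - z / (l : L))‖ = ‖∏ l ∈ hS.ballSubtype ‖z‖, (1 - z / (l : L))‖ := by
  classical
  rw [← Finset.prod_sdiff hs, norm_mul, norm_prod, Finset.prod_eq_one, one_mul]
  intro l hl
  rw [Finset.mem_sdiff, hS.mem_ballSubtype, not_le] at hl
  exact norm_one_sub_div_eq_one hl.2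

theorem IsDiscreteSet.multipliable [CompleteSpace L] (z : L) :
    Multipliable fun l : {l : L // l ∈ S ∧ l ≠ 0} => 1 - z / (l : L) := by
  classical
  have hc : CauchySeq fun s : Finset {l : L // l ∈ S ∧ l ≠ 0} => ∏ l ∈ s, (1 - z / (l : L)) := by
    rw [Metric.cauchySeq_iff']
    intro ε hε
    set M := ‖∏ l ∈ hS.ballSubtype ‖z‖, (1 - z / (l : L))‖ with hM
    have hM0 : 0 ≤ M := norm_nonneg _
    -- The first entry puts each outside factor within `‖z‖/R ≤ 1` of 1; the second makes the total
    -- error `M‖z‖/R` smaller than `ε`, strictly because of the `+ 1`.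
    set R := max (‖z‖ + 1) ((M * ‖z‖ + 1) / ε) with hR
    have hz0 := norm_nonneg z
    have hR0 : 0 < R := lt_of_lt_of_le (by positivity) (le_max_left _ _)
    have hzR : ‖z‖ ≤ R := (by linarith : ‖z‖ ≤ ‖z‖ + 1).trans (le_max_left _ _)
    have hMR : M * ‖z‖ + 1 ≤ R * ε := (div_le_iff₀ hε).1 (le_max_right _ _)
    refine ⟨hS.ballSubtype R, fun s hs => ?_⟩
    have h1 : hS.ballSubtype ‖z‖ ⊆ hS.ballSubtype R := fun l hl => by
      rw [hS.mem_ballSubtype] at hl ⊢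
      exact hl.trans hzR
    rw [dist_eq_norm, ← Finset.prod_sdiff hs, ← sub_one_mul, norm_mul,
      hS.norm_prod_eq z h1, ← hM]
    have h2 : ‖∏ l ∈ s \ hS.ballSubtype R, (1 - z / (l : L)) - 1‖ ≤ ‖z‖ / R := by
      refine norm_prod_sub_one_le (by positivity) ((div_le_one hR0).2 hzR) _ fun l hl => ?_
      rw [Finset.mem_sdiff, hS.mem_ballSubtype, not_le] at hl
      rw [sub_sub_cancel_left, norm_neg, norm_div]
      exact div_le_div_of_nonneg_left hz0 hR0 hl.2.le
    calc _ ≤ ‖z‖ / R * M := mul_le_mul_of_nonneg_right h2 hM0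
      _ = M * ‖z‖ / R := by ring
      _ < ε := by rw [div_lt_iff₀ hR0]; linarith
  exact (cauchySeq_tendsto_of_complete hc).imp fun a ha => by simpa [HasProd] using ha

theorem IsDiscreteSet.tendsto_finsetExp [CompleteSpace L] (z : L) :
    Tendsto (fun R => finsetExp (hS.ball R) z) atTop (𝓝 (setExp S z)) := by
  classical
  have h : Tendsto (fun R => ∏ l ∈ hS.ballSubtype R, (1 - z / (l : L))) atTop
      (𝓝 (∏' l : {l : L // l ∈ S ∧ l ≠ 0}, (1 - z / (l : L)))) := by
    have h1 := (hS.multipliable z).hasProd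
    simp only [HasProd, SummationFilter.unconditional_filter] at h1
    exact h1.comp hS.tendsto_ballSubtype
  refine (h.const_mul z).congr fun R => ?_
  rw [finsetExp, hS.prod_ballSubtype R fun l => 1 - z / l]

open Classical in
theorem IsDiscreteSet.norm_setExp [CompleteSpace L] (z : L) :
    ‖setExp S z‖ = ‖z‖ * ∏ l ∈ (hS.ball ‖z‖).erase 0, ‖1 - z / l‖ := by
  refine tendsto_nhds_unique (hS.tendsto_finsetExp z).norm (tendsto_const_nhds.congr' ?_)
  filter_upwards [eventually_ge_atTop ‖z‖] with R hR
  rw [finsetExp, norm_mul, ← hS.prod_ballSubtype R fun l => 1 - z / l,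
    hS.norm_prod_eq, hS.prod_ballSubtype ‖z‖ fun l => 1 - z / l, norm_prod]
  intro l hl
  rw [hS.mem_ballSubtype] at hl ⊢
  exact hl.trans hR

theorem IsDiscreteSet.setExp_ne_zero [CompleteSpace L] (h0 : 0 ∈ S) {z : L} (hz : z ∉ S) :
    setExp S z ≠ 0 := by
  classical
  rw [← norm_ne_zero_iff, hS.norm_setExp]
  refine mul_ne_zero (norm_ne_zero_iff.2 fun h => hz (h ▸ h0))
    (Finset.prod_ne_zero_iff.2 fun l hl => norm_ne_zero_iff.2 (sub_ne_zero.2 fun h => hz ?_))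
  rw [Finset.mem_erase, hS.mem_ball] at hl
  rw [eq_comm, div_eq_one_iff_eq hl.1] at h
  exact h ▸ hl.2.1

end InfiniteExp

/-! ### Exponentials of homothetic sets. -/

section Scaling

theorem setExp_smul_set {L : Type*} [NormedField L] {S S' : Set L} {c : L} (hc : c ≠ 0)
    (h : ∀ x, c * x ∈ S' ↔ x ∈ S) (z : L) : setExp S' (c * z) = c * setExp S z := by
  rw [setExp, setExp, mul_assoc]
  congr 2
  let e : {l : L // l ∈ S ∧ l ≠ 0} ≃ {l : L // l ∈ S' ∧ l ≠ 0} :=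
    (Equiv.mulLeft₀ c hc).subtypeEquiv fun a => by simp [h, hc]
  rw [← e.tprod_eq]
  refine tprod_congr fun l => ?_
  change 1 - c * z / (c * l) = _
  rw [mul_div_mul_left _ _ hc]

end Scaling

/-! ### Exponentials of discrete `F`-subspaces, as limits of the finite ones. -/

section Submodule

open Filter Topology

variable {L : Type*} [NormedField L] [IsUltrametricDist L]
  {F : Type*} [Field F] [Finite F] [Algebra F L]

omit [IsUltrametricDist L] in
theorem norm_algebraMap_of_finite {α : F} (hα : α ≠ 0) : ‖algebraMap F L α‖ = 1 := by
  have := Fintype.ofFinite F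
  have h : ‖algebraMap F L α‖ ^ (Fintype.card F - 1) = 1 := by
    rw [← norm_pow, ← map_pow, FiniteField.pow_card_sub_one_eq_one α hα, map_one, norm_one]
  exact (pow_eq_one_iff_of_nonneg (norm_nonneg _)
    (Nat.sub_ne_zero_of_lt Fintype.one_lt_card)).1 h

omit [IsUltrametricDist L] in
theorem norm_smul_le_of_finite (α : F) (x : L) : ‖α • x‖ ≤ ‖x‖ := by
  rcases eq_or_ne α 0 with rfl | hα
  · simp
  · rw [Algebra.smul_def, norm_mul, norm_algebraMap_of_finite hα, one_mul]

variable {V : Submodule F L} (hV : IsDiscreteSet (V : Set L))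
include hV

omit [IsUltrametricDist L] [Finite F] in
theorem IsDiscreteSet.zero_mem_ball {R : ℝ} (hR : 0 ≤ R) : 0 ∈ hV.ball R :=
  hV.mem_ball.2 ⟨V.zero_mem, by simpa⟩

omit [Finite F] in
theorem IsDiscreteSet.add_mem_ball {R : ℝ} :
    ∀ x ∈ hV.ball R, ∀ y ∈ hV.ball R, x + y ∈ hV.ball R := by
  intro x hx y hy
  rw [hV.mem_ball] at hx hy ⊢
  exact ⟨V.add_mem hx.1 hy.1, (IsUltrametricDist.norm_add_le_max _ _).trans (max_le hx.2 hy.2)⟩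

omit [IsUltrametricDist L] in
theorem IsDiscreteSet.smul_mem_ball {R : ℝ} :
    ∀ α : F, ∀ x ∈ hV.ball R, α • x ∈ hV.ball R := by
  intro α x hx
  rw [hV.mem_ball] at hx ⊢
  exact ⟨V.smul_mem α hx.1, (norm_smul_le_of_finite α x).trans hx.2⟩

variable [CompleteSpace L]

omit [Finite F] in
theorem IsDiscreteSet.setExp_add (y z : L) :
    setExp (V : Set L) (y + z) = setExp (V : Set L) y + setExp (V : Set L) z := by
  refine tendsto_nhds_unique (hV.tendsto_finsetExp (y + z))
    (((hV.tendsto_finsetExp y).add (hV.tendsto_finsetExp z)).congr' ?_)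
  filter_upwards [eventually_ge_atTop 0] with R hR
  rw [finsetExp_add (hV.zero_mem_ball hR) hV.add_mem_ball]

theorem IsDiscreteSet.setExp_smul (α : F) (z : L) :
    setExp (V : Set L) (α • z) = α • setExp (V : Set L) z := by
  simp only [Algebra.smul_def]
  refine tendsto_nhds_unique (hV.tendsto_finsetExp _)
    (((hV.tendsto_finsetExp z).const_mul (algebraMap F L α)).congr fun R => ?_)
  rw [← Algebra.smul_def, ← Algebra.smul_def, finsetExp_smul hV.smul_mem_ball]

theorem IsDiscreteSet.setExp_adjoin {V' : Submodule F L} (hV' : IsDiscreteSet (V' : Set L))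
    {w : L} (hw : w ∉ V) (h : ∀ x, x ∈ V' ↔ ∃ α : F, ∃ v ∈ V, x = α • w + v) (z : L) :
    setExp (V' : Set L) z = setExp (V : Set L) z -
      setExp (V : Set L) z ^ Nat.card F / setExp (V : Set L) w ^ (Nat.card F - 1) := by
  have hne := hV.setExp_ne_zero V.zero_mem hw
  have hz := hV.tendsto_finsetExp z
  refine tendsto_nhds_unique (hV'.tendsto_finsetExp z) ((hz.sub ((hz.pow (Nat.card F)).div
    ((hV.tendsto_finsetExp w).pow _) (pow_ne_zero (Nat.card F - 1) hne))).congr' ?_)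
  -- Once `R ≥ ‖w‖`, the `R`-ball of `V'` is the `R`-ball of `V` with `w` adjoined, so the finite
  -- formula applies.
  filter_upwards [eventually_ge_atTop ‖w‖] with R hR
  refine (finsetExp_adjoin (hV.zero_mem_ball ((norm_nonneg w).trans hR)) hV.add_mem_ball
    hV.smul_mem_ball (fun hm => hw (hV.mem_ball.1 hm).1) (fun x => ?_) z).symm
  have hαw : ∀ α : F, ‖α • w‖ ≤ R := fun α => (norm_smul_le_of_finite α w).trans hR
  simp only [hV'.mem_ball, hV.mem_ball, SetLike.mem_coe, h]
  constructor
  · rintro ⟨⟨α, v, hv, rfl⟩, hx⟩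
    refine ⟨α, v, ⟨hv, ?_⟩, rfl⟩
    have := IsUltrametricDist.norm_add_le_max (α • w + v) (-(α • w))
    rw [add_neg_cancel_comm, norm_neg] at this
    exact this.trans (max_le hx (hαw α))
  · rintro ⟨α, v, ⟨hv, hvR⟩, rfl⟩
    exact ⟨⟨α, v, hv, rfl⟩, (IsUltrametricDist.norm_add_le_max _ _).trans (max_le (hαw α) hvR)⟩

end Submodule

/-! ### Norms of polynomials and orthogonality of `1` and `ω`. -/

section Norms

variable {F : Type*} [Field F] [Finite F]

theorem one_lt_card_real : (1 : ℝ) < Nat.card F := by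
  exact_mod_cast Finite.one_lt_card

theorem norm_algebraMap_KInf (x : KInf F) : ‖algebraMap (KInf F) (CInf F) x‖ = ‖x‖ :=
  norm_algebraMap' (CInf F) x

theorem norm_polynomial_KInf {b : F[X]} (hb : b ≠ 0) :
    ‖algebraMap (RatFunc F) (KInf F) (algebraMap F[X] (RatFunc F) b)‖ =
      (Nat.card F : ℝ) ^ b.natDegree := by
  rw [norm_eq, valued_algebraMap, @RatFunc.inftyValuation_apply F _ (Classical.decEq _),
    @RatFunc.inftyValuation.polynomial F _ (Classical.decEq _) b hb,
    WithZeroMulInt.toNNReal_neg_apply _ WithZero.exp_ne_zero]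
  simp [WithZero.exp]

theorem norm_polynomial {b : F[X]} (hb : b ≠ 0) :
    ‖algebraMap F[X] (CInf F) b‖ = (Nat.card F : ℝ) ^ b.natDegree :=
  (norm_algebraMap_KInf _).trans (norm_polynomial_KInf hb)

/-- Only the case of two terms of equal norm is not automatic. There `xω + y = x(ω + y/x)`, and `|ω
+ y/x| ≥ |ω|_i = q^ℓ` rules out cancellation. -/
theorem norm_mul_add_eq_max {ℓ : ℕ} {ω : CInf F} (hω : ω ∈ fundDomainPart F ℓ) (x y : KInf F) :
    ‖algebraMap (KInf F) (CInf F) x * ω + algebraMap (KInf F) (CInf F) y‖ =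
      max (‖x‖ * (Nat.card F : ℝ) ^ ℓ) ‖y‖ := by
  obtain ⟨-, h1, h2⟩ := hω
  have hx : ‖algebraMap (KInf F) (CInf F) x * ω‖ = ‖x‖ * (Nat.card F : ℝ) ^ ℓ := by
    rw [norm_mul, norm_algebraMap_KInf, h1]
  by_cases hne : ‖x‖ * (Nat.card F : ℝ) ^ ℓ = ‖y‖
  · refine le_antisymm ?_ ?_
    · rw [← hx, ← norm_algebraMap_KInf y]
      exact IsUltrametricDist.norm_add_le_max _ _
    · rw [← hne, max_self]
      rcases eq_or_ne x 0 with rfl | hx0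
      · simp
      have h3 : (Nat.card F : ℝ) ^ ℓ ≤ ‖ω - algebraMap (KInf F) (CInf F) (-(y / x))‖ := by
        rw [← h2]
        exact ciInf_le ⟨0, by rintro _ ⟨z, rfl⟩; exact norm_nonneg _⟩ _
      have hx1 : algebraMap (KInf F) (CInf F) x ≠ 0 := by simpa using hx0
      have h4 : algebraMap (KInf F) (CInf F) x * ω + algebraMap (KInf F) (CInf F) y =
          algebraMap (KInf F) (CInf F) x * (ω - algebraMap (KInf F) (CInf F) (-(y / x))) := by
        rw [map_neg, map_div₀]
        field_simp
        ring
      rw [h4, norm_mul, norm_algebraMap_KInf]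
      exact mul_le_mul_of_nonneg_left h3 (norm_nonneg _)
  · rw [IsUltrametricDist.norm_add_eq_max_of_norm_ne_norm, hx, norm_algebraMap_KInf]
    rwa [hx, norm_algebraMap_KInf]

theorem norm_polynomial_mul_add {ℓ : ℕ} {ω : CInf F} (hω : ω ∈ fundDomainPart F ℓ) (a b : F[X]) :
    ‖algebraMap F[X] (CInf F) a * ω + algebraMap F[X] (CInf F) b‖ =
      max (‖algebraMap F[X] (CInf F) a‖ * (Nat.card F : ℝ) ^ ℓ) ‖algebraMap F[X] (CInf F) b‖ := by
  have := norm_mul_add_eq_max hω (algebraMap (RatFunc F) (KInf F) (algebraMap F[X] (RatFunc F) a))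
    (algebraMap (RatFunc F) (KInf F) (algebraMap F[X] (RatFunc F) b))
  rw [← norm_algebraMap_KInf, ← norm_algebraMap_KInf] at this
  exact this

theorem norm_algebraMap_polynomial_le_iff {b : F[X]} {k : ℕ} :
    ‖algebraMap F[X] (CInf F) b‖ ≤ (Nat.card F : ℝ) ^ k ↔ b.natDegree ≤ k := by
  rcases eq_or_ne b 0 with rfl | hb
  · simp
  · rw [norm_polynomial hb]
    exact pow_le_pow_iff_right₀ one_lt_card_real

theorem one_le_norm_polynomial {b : F[X]} (hb : b ≠ 0) : 1 ≤ ‖algebraMap F[X] (CInf F) b‖ := by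
  rw [norm_polynomial hb]
  exact one_le_pow₀ one_lt_card_real.le

theorem algebraMap_polynomial_injective : Function.Injective (algebraMap F[X] (CInf F)) := by
  rw [injective_iff_map_eq_zero]
  intro b hb
  by_contra h
  have := one_le_norm_polynomial h
  rw [hb, norm_zero] at this
  linarith

end Norms

/-! ### The lattice `Aω + A`: discreteness, rank, minimal norm. -/

section Lattice

variable {F : Type*} [Field F] [Finite F]

theorem embed_pair (ω : CInf F) (v : Fin 2 → RatFunc F) :
    embed ![ω, 1] v = algebraMap (RatFunc F) (CInf F) (v 0) * ω +
      algebraMap (RatFunc F) (CInf F) (v 1) := by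
  simp [embed, Fintype.linearCombination_apply, Fin.sum_univ_two, Algebra.smul_def]

theorem mem_latticeOf_stdLattice {ω x : CInf F} :
    x ∈ latticeOf (stdLattice F 2) ![ω, 1] ↔
      ∃ a b : F[X], x = algebraMap F[X] (CInf F) a * ω + algebraMap F[X] (CInf F) b := by
  simp only [latticeOf, stdLattice, Submodule.mem_map, Submodule.mem_pi, embed_pair]
  constructor
  · rintro ⟨v, hv, rfl⟩
    obtain ⟨a, ha⟩ := hv 0 trivial
    obtain ⟨b, hb⟩ := hv 1 trivial
    exact ⟨a, b, by rw [← ha, ← hb]; rfl⟩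
  · rintro ⟨a, b, rfl⟩
    refine ⟨![algebraMap F[X] (RatFunc F) a, algebraMap F[X] (RatFunc F) b], ?_, rfl⟩
    intro i _
    fin_cases i
    · exact ⟨a, rfl⟩
    · exact ⟨b, rfl⟩

variable (F) in
theorem finite_degreeLT (n : ℕ) : {b : F[X] | b.degree < n}.Finite := by
  have : Finite (degreeLT F n) := Finite.of_equiv _ (degreeLTEquiv F n).toEquiv.symm
  refine (Set.toFinite (degreeLT F n : Set F[X])).subset fun b hb => ?_
  exact mem_degreeLT.2 hb

variable {ℓ : ℕ} {ω : CInf F} (hω : ω ∈ fundDomainPart F ℓ)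
include hω

theorem isDiscreteSet_lattice :
    IsDiscreteSet (latticeOf (stdLattice F 2) ![ω, 1] : Set (CInf F)) := by
  intro R
  obtain ⟨N, hN⟩ := pow_unbounded_of_one_lt R (one_lt_card_real (F := F))
  refine (((finite_degreeLT F (N + 1)).prod (finite_degreeLT F (N + 1))).image fun p =>
    algebraMap F[X] (CInf F) p.1 * ω + algebraMap F[X] (CInf F) p.2).subset ?_
  rintro x ⟨hx, hxR⟩
  obtain ⟨a, b, rfl⟩ := mem_latticeOf_stdLattice.1 hx
  rw [norm_polynomial_mul_add hω] at hxR
  have h1 : (1 : ℝ) ≤ (Nat.card F : ℝ) ^ ℓ := one_le_pow₀ one_lt_card_real.le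
  have ha : a.natDegree ≤ N := norm_algebraMap_polynomial_le_iff.1
    ((le_mul_of_one_le_right (norm_nonneg _) h1).trans
      ((le_max_left _ _).trans (hxR.trans hN.le)))
  have hb : b.natDegree ≤ N := norm_algebraMap_polynomial_le_iff.1
    ((le_max_right _ _).trans (hxR.trans hN.le))
  refine ⟨(a, b), ⟨?_, ?_⟩, rfl⟩
  · exact lt_of_le_of_lt (natDegree_le_iff_degree_le.1 ha) (by exact_mod_cast N.lt_succ_self)
  · exact lt_of_le_of_lt (natDegree_le_iff_degree_le.1 hb) (by exact_mod_cast N.lt_succ_self)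

theorem polynomial_mul_add_eq_zero {a b : F[X]}
    (h : algebraMap F[X] (CInf F) a * ω + algebraMap F[X] (CInf F) b = 0) : a = 0 ∧ b = 0 := by
  have h1 := norm_polynomial_mul_add hω a b
  rw [h, norm_zero] at h1
  have hq : (0 : ℝ) < (Nat.card F : ℝ) ^ ℓ := pow_pos (zero_lt_one.trans one_lt_card_real) _
  constructor
  · by_contra ha
    have h2 := one_le_norm_polynomial ha
    have := le_max_left (‖algebraMap F[X] (CInf F) a‖ * (Nat.card F : ℝ) ^ ℓ)
      ‖algebraMap F[X] (CInf F) b‖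
    nlinarith
  · by_contra hb
    have h2 := one_le_norm_polynomial hb
    have := le_max_right (‖algebraMap F[X] (CInf F) a‖ * (Nat.card F : ℝ) ^ ℓ)
      ‖algebraMap F[X] (CInf F) b‖
    linarith

theorem finrank_lattice :
    Module.finrank F[X] (latticeOf (stdLattice F 2) ![ω, 1]) = 2 := by
  have hspan : latticeOf (stdLattice F 2) ![ω, 1] = Submodule.span F[X] (Set.range ![ω, 1]) := by
    ext x
    rw [mem_latticeOf_stdLattice, Submodule.mem_span_range_iff_exists_fun]
    constructor
    · rintro ⟨a, b, rfl⟩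
      exact ⟨![a, b], by simp [Fin.sum_univ_two, Algebra.smul_def]⟩
    · rintro ⟨c, rfl⟩
      exact ⟨c 0, c 1, by simp [Fin.sum_univ_two, Algebra.smul_def]⟩
  rw [hspan, finrank_span_eq_card, Fintype.card_fin]
  rw [LinearIndependent.pair_iff]
  intro s t hst
  exact polynomial_mul_add_eq_zero hω (by simpa [Algebra.smul_def] using hst)

theorem one_le_norm_of_mem_lattice {x : CInf F} (hx : x ∈ latticeOf (stdLattice F 2) ![ω, 1])
    (hx0 : x ≠ 0) : 1 ≤ ‖x‖ := by
  obtain ⟨a, b, rfl⟩ := mem_latticeOf_stdLattice.1 hx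
  rw [norm_polynomial_mul_add hω]
  rcases eq_or_ne a 0 with rfl | ha
  · rcases eq_or_ne b 0 with rfl | hb
    · simp at hx0
    · exact (one_le_norm_polynomial hb).trans (le_max_right _ _)
  · refine (one_le_norm_polynomial ha).trans ((le_mul_of_one_le_right (norm_nonneg _) ?_).trans
      (le_max_left _ _))
    exact one_le_pow₀ one_lt_card_real.le

end Lattice

/-! ### Norms of the exponential at points with coordinates of norm below 1. -/

section DivisionForm

variable {F : Type*} [Field F] [Finite F]

/-- A nonzero polynomial has norm at least 1, so it dominates `x` in the difference. -/
theorem norm_polynomial_le_norm_sub {x : KInf F} (hx : ‖x‖ < 1) (b : F[X]) :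
    ‖algebraMap F[X] (CInf F) b‖ ≤
      ‖x - algebraMap (RatFunc F) (KInf F) (algebraMap F[X] (RatFunc F) b)‖ := by
  rcases eq_or_ne b 0 with rfl | hb
  · simp
  have h1 := one_le_norm_polynomial hb
  rw [show ‖algebraMap F[X] (CInf F) b‖ =
    ‖algebraMap (RatFunc F) (KInf F) (algebraMap F[X] (RatFunc F) b)‖ from
      norm_algebraMap_KInf _] at h1 ⊢
  rw [sub_eq_add_neg, IsUltrametricDist.norm_add_eq_max_of_norm_ne_norm, norm_neg]
  · exact le_max_right _ _
  · rw [norm_neg]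
    exact (hx.trans_le h1).ne

variable {ℓ : ℕ} {ω : CInf F} (hω : ω ∈ fundDomainPart F ℓ)
include hω

theorem norm_le_norm_sub_of_mem_lattice {x y : KInf F} (hx : ‖x‖ < 1) (hy : ‖y‖ < 1) {l : CInf F}
    (hl : l ∈ latticeOf (stdLattice F 2) ![ω, 1]) :
    ‖l‖ ≤ ‖algebraMap (KInf F) (CInf F) x * ω + algebraMap (KInf F) (CInf F) y - l‖ := by
  obtain ⟨a, b, rfl⟩ := mem_latticeOf_stdLattice.1 hl
  have h := norm_mul_add_eq_max hω
    (x - algebraMap (RatFunc F) (KInf F) (algebraMap F[X] (RatFunc F) a))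
    (y - algebraMap (RatFunc F) (KInf F) (algebraMap F[X] (RatFunc F) b))
  have h2 : algebraMap (KInf F) (CInf F) x * ω + algebraMap (KInf F) (CInf F) y -
      (algebraMap F[X] (CInf F) a * ω + algebraMap F[X] (CInf F) b) =
      algebraMap (KInf F) (CInf F)
        (x - algebraMap (RatFunc F) (KInf F) (algebraMap F[X] (RatFunc F) a)) * ω +
      algebraMap (KInf F) (CInf F)
        (y - algebraMap (RatFunc F) (KInf F) (algebraMap F[X] (RatFunc F) b)) := by
    rw [map_sub, map_sub]
    change _ - (algebraMap (KInf F) (CInf F) _ * ω + algebraMap (KInf F) (CInf F) _) = _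
    ring
  rw [h2, h, norm_polynomial_mul_add hω]
  exact max_le_max (mul_le_mul_of_nonneg_right (norm_polynomial_le_norm_sub hx a)
    (by positivity)) (norm_polynomial_le_norm_sub hy b)

-- For `|l| < |u|` the numerator `|u - l|` is `|u|` by the ultrametric inequality. For `|l| = |u|`
-- the lower bound `|u - l| ≥ |l|` is needed to exclude cancellation.
open Classical in
theorem norm_setExp_lattice {x y : KInf F} (hx : ‖x‖ < 1) (hy : ‖y‖ < 1) {u : CInf F}
    (hu : u = algebraMap (KInf F) (CInf F) x * ω + algebraMap (KInf F) (CInf F) y) :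
    ‖setExp (latticeOf (stdLattice F 2) ![ω, 1] : Set (CInf F)) u‖ =
      ‖u‖ * ∏ l ∈ ((isDiscreteSet_lattice hω).ball ‖u‖).erase 0, (‖u‖ / ‖l‖) := by
  rw [(isDiscreteSet_lattice hω).norm_setExp]
  congr 1
  refine Finset.prod_congr rfl fun l hl => ?_
  rw [Finset.mem_erase, IsDiscreteSet.mem_ball] at hl
  obtain ⟨hl0, hlm, hlu⟩ := hl
  rw [one_sub_div hl0, norm_div, norm_sub_rev]
  congr 1
  rcases hlu.lt_or_eq with h | h
  · rw [sub_eq_add_neg, IsUltrametricDist.norm_add_eq_max_of_norm_ne_norm, norm_neg,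
      max_eq_left h.le]
    rw [norm_neg]
    exact h.ne'
  · refine le_antisymm ?_ ?_
    · rw [sub_eq_add_neg]
      refine (IsUltrametricDist.norm_add_le_max _ _).trans (max_le le_rfl ?_)
      rw [norm_neg, h]
    · rw [← h]
      conv_rhs => rw [hu]
      exact norm_le_norm_sub_of_mem_lattice hω hx hy hlm

theorem norm_setExp_of_norm_lt_one {x y : KInf F} (hx : ‖x‖ < 1) (hy : ‖y‖ < 1) {u : CInf F}
    (hu : u = algebraMap (KInf F) (CInf F) x * ω + algebraMap (KInf F) (CInf F) y)
    (h1 : ‖u‖ < 1) :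
    ‖setExp (latticeOf (stdLattice F 2) ![ω, 1] : Set (CInf F)) u‖ = ‖u‖ := by
  classical
  rw [norm_setExp_lattice hω hx hy hu, Finset.prod_eq_one, mul_one]
  intro l hl
  rw [Finset.mem_erase, IsDiscreteSet.mem_ball] at hl
  have := one_le_norm_of_mem_lattice hω hl.2.1 hl.1
  linarith [hl.2.2]

-- Passing from `k` to `k + 1` multiplies the prefactor and each of the `q^(k+1) - 1` old factors by
-- `q`, which gives `q^(q^(k+1))` in all. The new polynomials have degree exactly `k + 1` and
-- contribute 1.
omit hω in
open Classical in
theorem prod_norm_polynomial_ratio (k : ℕ) :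
    (Nat.card F : ℝ) ^ k * ∏ b ∈ (finite_degreeLT F (k + 1)).toFinset.erase 0,
      ((Nat.card F : ℝ) ^ k / ‖algebraMap F[X] (CInf F) b‖) =
    (Nat.card F : ℝ) ^ (∑ j ∈ Finset.range k, Nat.card F ^ (j + 1)) := by
  have hq : (Nat.card F : ℝ) ≠ 0 := (zero_lt_one.trans one_lt_card_real).ne'
  have hcard : ∀ n, (finite_degreeLT F n).toFinset.card = Nat.card F ^ n := fun n => by
    rw [← Set.ncard_eq_toFinset_card _ (finite_degreeLT F n), ← Nat.card_coe_set_eq]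
    refine (Nat.card_congr ((Equiv.subtypeEquivRight fun b : F[X] =>
      (mem_degreeLT (n := n) (f := b)).symm).trans (degreeLTEquiv F n).toEquiv)).trans ?_
    rw [Nat.card_fun, Nat.card_eq_fintype_card (α := Fin n), Fintype.card_fin]
  induction k with
  | zero =>
    rw [pow_zero, one_mul, Finset.range_zero, Finset.sum_empty, pow_zero]
    refine Finset.prod_eq_one fun b hb => ?_
    simp only [Finset.mem_erase, Set.Finite.mem_toFinset, Set.mem_ofPred_eq] at hb
    have h1 := (natDegree_lt_iff_degree_lt hb.1).2 hb.2
    rw [norm_polynomial hb.1, Nat.lt_one_iff.1 h1, pow_zero, div_one]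
  | succ k ih =>
    have hsub : (finite_degreeLT F (k + 1)).toFinset.erase 0 ⊆
        (finite_degreeLT F (k + 1 + 1)).toFinset.erase 0 := by
      refine Finset.erase_subset_erase _ fun b hb => ?_
      simp only [Set.Finite.mem_toFinset, Set.mem_ofPred_eq] at hb ⊢
      exact hb.trans (by exact_mod_cast (k + 1).lt_succ_self)
    rw [← Finset.prod_subset hsub]
    · have h1 : ∀ b ∈ (finite_degreeLT F (k + 1)).toFinset.erase 0,
          (Nat.card F : ℝ) ^ (k + 1) / ‖algebraMap F[X] (CInf F) b‖ =
          Nat.card F * ((Nat.card F : ℝ) ^ k / ‖algebraMap F[X] (CInf F) b‖) := fun b _ => by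
        rw [pow_succ']
        ring
      rw [Finset.prod_congr rfl h1, Finset.prod_mul_distrib, Finset.prod_const,
        Finset.card_erase_of_mem (by simp), hcard, Finset.sum_range_succ, pow_add _ (∑ j ∈ Finset.range k, _),
        ← ih, pow_succ']
      have h2 : (Nat.card F : ℝ) ^ (Nat.card F ^ (k + 1)) =
          Nat.card F * (Nat.card F : ℝ) ^ (Nat.card F ^ (k + 1) - 1) := by
        rw [← pow_succ', Nat.sub_add_cancel (Nat.one_le_pow _ _ Nat.card_pos)]
      rw [h2]
      ring
    · intro b hb hb'
      simp only [Finset.mem_erase, Set.Finite.mem_toFinset, Set.mem_ofPred_eq, not_and,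
        not_lt] at hb hb'
      have hd : b.natDegree = k + 1 := by
        have h1 := (natDegree_lt_iff_degree_lt hb.1).2 hb.2
        have h3 := hb' hb.1
        rw [degree_eq_natDegree hb.1] at h3
        have : k + 1 ≤ b.natDegree := by exact_mod_cast h3
        omega
      rw [norm_polynomial hb.1, hd, div_self (pow_ne_zero _ hq)]

theorem norm_setExp_of_norm_eq_pow {x y : KInf F} (hx : ‖x‖ < 1) (hy : ‖y‖ < 1) {u : CInf F}
    (hu : u = algebraMap (KInf F) (CInf F) x * ω + algebraMap (KInf F) (CInf F) y)
    {k : ℕ} (hk : k < ℓ) (h1 : ‖u‖ = (Nat.card F : ℝ) ^ k) :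
    ‖setExp (latticeOf (stdLattice F 2) ![ω, 1] : Set (CInf F)) u‖ =
      (Nat.card F : ℝ) ^ (∑ j ∈ Finset.range k, Nat.card F ^ (j + 1)) := by
  classical
  rw [norm_setExp_lattice hω hx hy hu, h1, ← prod_norm_polynomial_ratio]
  congr 1
  have himg : ((isDiscreteSet_lattice hω).ball ((Nat.card F : ℝ) ^ k)).erase 0 =
      ((finite_degreeLT F (k + 1)).toFinset.erase 0).image (algebraMap F[X] (CInf F)) := by
    ext l
    simp only [Finset.mem_erase, IsDiscreteSet.mem_ball, Finset.mem_image,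
      Set.Finite.mem_toFinset, Set.mem_ofPred_eq, SetLike.mem_coe, mem_latticeOf_stdLattice]
    constructor
    · rintro ⟨hl0, ⟨a, b, rfl⟩, hl⟩
      rw [norm_polynomial_mul_add hω] at hl
      -- Any `aω + b` with `a ≠ 0` has norm at least `q^ℓ > q^k`; only constants in `A` lie in the
      -- ball.
      have ha : a = 0 := by
        by_contra ha
        have h2 := one_le_norm_polynomial ha
        have h3 := (le_max_left _ _).trans hl
        have h4 : (Nat.card F : ℝ) ^ k < (Nat.card F : ℝ) ^ ℓ :=
          pow_lt_pow_right₀ one_lt_card_real hk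
        have h5 : (0 : ℝ) < (Nat.card F : ℝ) ^ ℓ := pow_pos (zero_lt_one.trans one_lt_card_real) _
        nlinarith
      subst ha
      rw [map_zero, zero_mul, zero_add] at hl0 ⊢
      have hb := norm_algebraMap_polynomial_le_iff.1 ((le_max_right _ _).trans hl)
      refine ⟨b, ⟨fun h => hl0 (by rw [h, map_zero]), ?_⟩, rfl⟩
      exact lt_of_le_of_lt (natDegree_le_iff_degree_le.1 hb) (by exact_mod_cast k.lt_succ_self)
    · rintro ⟨b, ⟨hb0, hb⟩, rfl⟩
      refine ⟨fun h => hb0 (algebraMap_polynomial_injective (by rw [h, map_zero])),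
        ⟨0, b, by simp⟩, norm_algebraMap_polynomial_le_iff.2 ?_⟩
      exact Nat.lt_succ_iff.1 ((natDegree_lt_iff_degree_lt hb0).2 hb)
  rw [himg, Finset.prod_image fun a _ b _ h => algebraMap_polynomial_injective h]

end DivisionForm

/-! ### From `φ_T` to `φ_a` for all `a`. -/

section DrinfeldPolynomial

variable {F : Type*} [Field F] [Finite F]

/-- The constants `F` in `C_∞`. -/
local instance constantsAlgebra : Algebra F (CInf F) :=
  ((algebraMap F[X] (CInf F)).comp C).toAlgebra

local instance constants_isScalarTower : IsScalarTower F F[X] (CInf F) := .of_algebraMap_eq fun _ => rfl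

theorem sub_pow_card (x y : CInf F) :
    (x - y) ^ Nat.card F = x ^ Nat.card F - y ^ Nat.card F := by
  have := Fintype.ofFinite F
  simpa [Nat.card_eq_fintype_card] using map_sub (FiniteField.frobeniusAlgHom F (CInf F)) x y

theorem sum_pow_card {ι : Type*} (s : Finset ι) (f : ι → CInf F) :
    (∑ i ∈ s, f i) ^ Nat.card F = ∑ i ∈ s, f i ^ Nat.card F := by
  have := Fintype.ofFinite F
  rw [Nat.card_eq_fintype_card]
  exact map_sum (FiniteField.frobeniusAlgHom F (CInf F)) f s

/-- The coefficients of `φ_T ∘ φ`, where `φ = ∑ c i X ^ (q ^ i)` and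
`φ_T = t X + g X ^ q + Δ X ^ (q ^ 2)`. -/
def compCoeff (t g Δ : CInf F) (c : ℕ → CInf F) : ℕ → CInf F
  | 0 => t * c 0
  | 1 => t * c 1 + g * c 0 ^ Nat.card F
  | i + 2 => t * c (i + 2) + g * c (i + 1) ^ Nat.card F + Δ * (c i ^ Nat.card F) ^ Nat.card F

/-- Each Frobenius raises the index by one, so the truncations `M + 2`, `M + 1`, `M` make the
identity exact with no boundary terms. -/
theorem sum_compCoeff (t g Δ x : CInf F) (c : ℕ → CInf F) (M : ℕ) :
    ∑ i ∈ Finset.range (M + 2), compCoeff t g Δ c i * x ^ (Nat.card F ^ i) =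
      t * ∑ i ∈ Finset.range (M + 2), c i * x ^ (Nat.card F ^ i) +
      g * (∑ i ∈ Finset.range (M + 1), c i * x ^ (Nat.card F ^ i)) ^ Nat.card F +
      Δ * ((∑ i ∈ Finset.range M, c i * x ^ (Nat.card F ^ i)) ^ Nat.card F) ^ Nat.card F := by
  have h : ∀ (b : ℕ → CInf F) (N : ℕ), (∑ i ∈ Finset.range N, b i * x ^ (Nat.card F ^ i)) ^
      Nat.card F = ∑ i ∈ Finset.range N, b i ^ Nat.card F * x ^ (Nat.card F ^ (i + 1)) := by
    intro b N
    rw [sum_pow_card]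
    refine Finset.sum_congr rfl fun i _ => ?_
    rw [mul_pow, ← pow_mul, pow_succ]
  have h2 : ((∑ i ∈ Finset.range M, c i * x ^ (Nat.card F ^ i)) ^ Nat.card F) ^ Nat.card F =
      ∑ i ∈ Finset.range M, (c i ^ Nat.card F) ^ Nat.card F * x ^ (Nat.card F ^ (i + 2)) := by
    rw [h, sum_pow_card]
    refine Finset.sum_congr rfl fun i _ => ?_
    rw [mul_pow, ← pow_mul x, ← pow_succ]
  rw [h, h2, Finset.sum_range_succ', Finset.sum_range_succ']
  rw [Finset.sum_range_succ' (fun i => c i * x ^ (Nat.card F ^ i)) (M + 1),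
    Finset.sum_range_succ' (fun i => c (i + 1) * x ^ (Nat.card F ^ (i + 1))) M,
    Finset.sum_range_succ' (fun i => c i ^ Nat.card F * x ^ (Nat.card F ^ (i + 1))) M]
  simp only [compCoeff, add_mul, Finset.sum_add_distrib, mul_add, Finset.mul_sum, mul_assoc]
  ring

/-- Induction on the Horner form: adding a constant changes only `c 0`, and multiplying by `T`
composes with `φ_T`. The expansion is stated for every `N` beyond the degree because `sum_compCoeff`
uses three truncations at once. -/
theorem exists_coeff_of_exp {e : CInf F → CInf F} (hadd : ∀ y z, e (y + z) = e y + e z)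
    (hsmul : ∀ (α : F) z, e (C α • z : CInf F) = algebraMap F[X] (CInf F) (C α) * e z)
    {g Δ : CInf F} (hT : ∀ z : CInf F, e ((X : F[X]) • z) = algebraMap F[X] (CInf F) X * e z +
      g * e z ^ Nat.card F + Δ * (e z ^ Nat.card F) ^ Nat.card F) (a : F[X]) :
    ∃ c : ℕ → CInf F, c 0 = algebraMap F[X] (CInf F) a ∧ (∀ i, 2 * a.natDegree < i → c i = 0) ∧
      c (2 * a.natDegree) = algebraMap F[X] (CInf F) (C a.leadingCoeff) *
        Δ ^ (∑ j ∈ Finset.range a.natDegree, (Nat.card F ^ 2) ^ j) ∧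
      ∀ (z : CInf F) (N : ℕ), 2 * a.natDegree < N →
        e (a • z) = ∑ i ∈ Finset.range N, c i * e z ^ (Nat.card F ^ i) := by
  have hq : Nat.card F ≠ 0 := Nat.card_pos.ne'
  have h0 : e 0 = 0 := by simpa using hadd 0 0
  induction a using Polynomial.recOnHorner with
  | M0 => exact ⟨0, by simp, by simp, by simp, fun z N _ => by simp [h0]⟩
  | MC p α hp hα ih =>
    obtain ⟨c, hc0, hc, hlead, hsum⟩ := ih
    refine ⟨fun i => c i + if i = 0 then algebraMap F[X] (CInf F) (C α) else 0, ?_, ?_, ?_, ?_⟩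
    · simp [hc0]
    · intro i hi
      rw [natDegree_add_C] at hi
      simp [hc i hi, Nat.ne_zero_of_lt hi]
    · rw [natDegree_add_C]
      rcases Nat.eq_zero_or_pos p.natDegree with hd | hd
      -- A constant could alter the top coefficient only if `p` were constant; as its constant term
      -- is zero, `p` is then zero.
      · have : p = 0 := by rw [eq_C_of_natDegree_eq_zero hd, hp, C_0]
        subst this
        simp [hc0]
      · dsimp only
        rw [hlead, if_neg (by omega), add_zero, leadingCoeff_add_of_degree_lt']
        exact lt_of_le_of_lt degree_C_le (natDegree_pos_iff_degree_pos.1 hd)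
    · intro z N hN
      rw [natDegree_add_C] at hN
      rw [add_smul, hadd, hsum z N hN, hsmul]
      simp only [add_mul, Finset.sum_add_distrib, ite_mul, zero_mul]
      rw [Finset.sum_ite_eq' (Finset.range N), if_pos (Finset.mem_range.2 (by omega)), pow_zero,
        pow_one]
  | MX p hp0 ih =>
    obtain ⟨c, hc0, hc, hlead, hsum⟩ := ih
    have hd : (p * X).natDegree = p.natDegree + 1 := natDegree_mul_X hp0
    refine ⟨compCoeff (algebraMap F[X] (CInf F) X) g Δ c, ?_, ?_, ?_, ?_⟩
    · rw [compCoeff, hc0, map_mul, mul_comm]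
    · intro i hi
      rw [hd] at hi
      obtain ⟨k, rfl⟩ : ∃ k, i = k + 2 := ⟨i - 2, by omega⟩
      rw [compCoeff, hc _ (by omega), hc _ (by omega), hc _ (by omega)]
      simp [hq]
    · rw [hd, leadingCoeff_mul_X, show 2 * (p.natDegree + 1) = 2 * p.natDegree + 2 by ring,
        compCoeff, hlead, hc _ (by omega), hc _ (by omega), Finset.sum_range_succ']
      have hα : algebraMap F[X] (CInf F) (C p.leadingCoeff) ^ Nat.card F =
          algebraMap F[X] (CInf F) (C p.leadingCoeff) := by
        have := Fintype.ofFinite F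
        rw [← map_pow, ← map_pow, Nat.card_eq_fintype_card, FiniteField.pow_card]
      rw [mul_pow, hα, mul_pow, hα, ← pow_mul, ← pow_mul, pow_add Δ, pow_zero, pow_one]
      -- Only the `Δ` term reaches the new top index; applying Frobenius twice multiplies the
      -- exponent of `Δ` by `q²`, and the extra `Δ` supplies the summand 1 of the geometric sum.
      have h3 : ∑ k ∈ Finset.range p.natDegree, (Nat.card F ^ 2) ^ (k + 1) =
          (∑ k ∈ Finset.range p.natDegree, (Nat.card F ^ 2) ^ k) * Nat.card F * Nat.card F := by
        rw [mul_assoc, Finset.sum_mul]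
        exact Finset.sum_congr rfl fun k _ => by ring
      rw [h3, zero_pow hq]
      ring
    · intro z N hN
      rw [hd] at hN
      obtain ⟨M, rfl⟩ : ∃ M, N = M + 2 := ⟨N - 2, by omega⟩
      rw [sum_compCoeff, mul_comm p, mul_smul, hT, ← hsum z (M + 2) (by omega),
        ← hsum z (M + 1) (by omega), ← hsum z M (by omega)]

theorem isCanonicalDiscriminant_of_exp_X_smul {Λ : Submodule F[X] (CInf F)}
    (hrank : Module.finrank F[X] Λ = 2)
    (hadd : ∀ y z, expLattice Λ (y + z) = expLattice Λ y + expLattice Λ z)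
    (hsmul : ∀ (α : F) z,
      expLattice Λ (C α • z : CInf F) = algebraMap F[X] (CInf F) (C α) * expLattice Λ z)
    {g Δ : CInf F} (hT : ∀ z : CInf F, expLattice Λ ((X : F[X]) • z) =
      algebraMap F[X] (CInf F) X * expLattice Λ z +
      g * expLattice Λ z ^ Nat.card F + Δ * (expLattice Λ z ^ Nat.card F) ^ Nat.card F) :
    IsCanonicalDiscriminant Λ Δ := by
  intro a _
  obtain ⟨c, hc0, -, hlead, hsum⟩ := exists_coeff_of_exp hadd hsmul hT a
  have hφ : ∑ i ∈ Finset.range (2 * a.natDegree + 1), C (c i) * X ^ (Nat.card F ^ i) =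
      C (algebraMap F[X] (CInf F) a) * X +
        ∑ i ∈ Finset.Icc 1 (2 * a.natDegree), C (c i) * X ^ (Nat.card F ^ i) := by
    rw [Finset.range_eq_Ico, Finset.sum_eq_sum_Ico_succ_bot (Nat.succ_pos _), hc0, pow_zero, pow_one]
    rfl
  refine ⟨∑ i ∈ Finset.range (2 * a.natDegree + 1), C (c i) * X ^ (Nat.card F ^ i),
    ⟨⟨c, ?_⟩, fun z => ?_⟩, ?_⟩
  · rw [hrank, hφ]
  · rw [hsum z _ (Nat.lt_succ_self _)]
    simp [eval_finsetSum]
  · have h2 : 2 ≤ Nat.card F ^ 2 := by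
      have : 2 ≤ Nat.card F := Finite.one_lt_card
      nlinarith
    rw [hrank, finsetSum_coeff, Finset.sum_eq_single (2 * a.natDegree)]
    · rw [coeff_C_mul, coeff_X_pow_self, mul_one, hlead, Nat.geomSum_eq h2, ← pow_mul]
    · intro i _ hi
      rw [coeff_C_mul, coeff_X_pow, if_neg, mul_zero]
      exact fun h => hi (Nat.pow_right_injective (Finite.one_lt_card (α := F)) h).symm
    · simp

end DrinfeldPolynomial

/-! ### The canonical discriminant: existence, norm, uniqueness. -/

section CanonicalDiscriminant

variable {F : Type*} [Field F] [Finite F]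

attribute [local instance] constantsAlgebra constants_isScalarTower

theorem norm_X_CInf : ‖algebraMap F[X] (CInf F) X‖ = Nat.card F := by
  rw [norm_polynomial X_ne_zero, natDegree_X, pow_one]

theorem X_CInf_ne_zero : algebraMap F[X] (CInf F) X ≠ 0 := by
  rw [Ne, map_eq_zero_iff _ algebraMap_polynomial_injective]
  exact X_ne_zero

theorem norm_C_KInf_div_X_lt_one (α : F) :
    ‖algebraMap (RatFunc F) (KInf F) (algebraMap F[X] (RatFunc F) (C α) /
      algebraMap F[X] (RatFunc F) X)‖ < 1 := by
  have hq := one_lt_card_real (F := F)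
  rw [map_div₀, norm_div, norm_polynomial_KInf X_ne_zero, natDegree_X, pow_one]
  rcases eq_or_ne α 0 with rfl | hα
  · simp
  · rw [norm_polynomial_KInf (C_ne_zero.2 hα), natDegree_C, pow_zero, div_lt_one (by linarith)]
    exact hq

theorem C_div_X_eq (α : F) : algebraMap F[X] (CInf F) (C α) / algebraMap F[X] (CInf F) X =
    algebraMap (KInf F) (CInf F) (algebraMap (RatFunc F) (KInf F)
      (algebraMap F[X] (RatFunc F) (C α) / algebraMap F[X] (RatFunc F) X)) := by
  rw [map_div₀, map_div₀]
  rfl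

theorem card_sub_one_mul_sum_pow (k : ℕ) :
    (Nat.card F - 1) * ∑ j ∈ Finset.range k, Nat.card F ^ j + 1 = Nat.card F ^ k := by
  have h := geom_sum_mul_add (Nat.card F - 1) k
  rw [Nat.sub_add_cancel (show 1 ≤ Nat.card F from Nat.card_pos)] at h
  rw [mul_comm, h]

/-- The final bookkeeping, with `m = q - 1`, `Q = q`, `B = q^(1 + q + ... + q^(ℓ-1))` and `D = ‖Δ‖`.
-/
theorem mul_pow_eq_of_norm_relation {m ℓ : ℕ} {Q B D : ℝ} (hQ : 0 < Q)
    (hB : B ^ m * Q = Q ^ ((m + 1) ^ ℓ))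
    (hD : D * ((B ^ (m + 1) * Q⁻¹) ^ m * (Q⁻¹ ^ m) ^ (m + 1)) = Q) :
    D * Q ^ ((m + 1) ^ (ℓ + 1)) = Q ^ ((m + 1) ^ 2 + (m + 1)) := by
  have h1 : D * (B ^ (m + 1)) ^ m = Q * Q ^ m * (Q ^ m) ^ (m + 1) := by
    rw [mul_pow, inv_pow, inv_pow] at hD
    have : Q ≠ 0 := hQ.ne'
    field_simp at hD
    linear_combination hD
  rw [pow_succ (m + 1) ℓ, pow_mul, ← hB, mul_pow, ← pow_mul, mul_comm m, pow_mul, ← mul_assoc, h1]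
  ring

theorem expLattice_eq_setExp (Λ : Submodule F[X] (CInf F)) (z : CInf F) :
    expLattice Λ z = setExp (Λ : Set (CInf F)) z := rfl

variable {ℓ : ℕ} {ω : CInf F} (hω : ω ∈ fundDomainPart F ℓ)
include hω

theorem expLattice_add (y z : CInf F) :
    expLattice (latticeOf (stdLattice F 2) ![ω, 1]) (y + z) =
      expLattice (latticeOf (stdLattice F 2) ![ω, 1]) y +
        expLattice (latticeOf (stdLattice F 2) ![ω, 1]) z :=
  IsDiscreteSet.setExp_add
    (V := (latticeOf (stdLattice F 2) ![ω, 1]).restrictScalars F) (isDiscreteSet_lattice hω) y z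

theorem expLattice_smul (α : F) (z : CInf F) :
    expLattice (latticeOf (stdLattice F 2) ![ω, 1]) (C α • z) =
      algebraMap F[X] (CInf F) (C α) * expLattice (latticeOf (stdLattice F 2) ![ω, 1]) z := by
  have := IsDiscreteSet.setExp_smul
    (V := (latticeOf (stdLattice F 2) ![ω, 1]).restrictScalars F) (isDiscreteSet_lattice hω) α z
  rw [Algebra.smul_def, Algebra.smul_def] at this
  rw [Algebra.smul_def]
  exact this

theorem norm_expLattice_one_div_X :
    ‖expLattice (latticeOf (stdLattice F 2) ![ω, 1]) (1 / algebraMap F[X] (CInf F) X)‖ =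
      (Nat.card F : ℝ)⁻¹ := by
  have hn : ‖1 / algebraMap F[X] (CInf F) X‖ = (Nat.card F : ℝ)⁻¹ := by
    rw [norm_div, norm_one, norm_X_CInf, one_div]
  rw [expLattice_eq_setExp, norm_setExp_of_norm_lt_one hω (norm_C_KInf_div_X_lt_one 0)
    (norm_C_KInf_div_X_lt_one 1), hn]
  · rw [← C_div_X_eq, ← C_div_X_eq]
    simp
  · rw [hn]
    exact inv_lt_one_of_one_lt₀ one_lt_card_real

theorem norm_expLattice_div_X {c : F} (hc : c ≠ 0) (α : F) :
    ‖expLattice (latticeOf (stdLattice F 2) ![ω, 1])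
      ((algebraMap F[X] (CInf F) (C c) * ω + algebraMap F[X] (CInf F) (C α)) /
        algebraMap F[X] (CInf F) X)‖ =
      (Nat.card F : ℝ) ^ (∑ j ∈ Finset.range ℓ, Nat.card F ^ j) * (Nat.card F : ℝ)⁻¹ := by
  set u := (algebraMap F[X] (CInf F) (C c) * ω + algebraMap F[X] (CInf F) (C α)) /
        algebraMap F[X] (CInf F) X with hu
  have hq := one_lt_card_real (F := F)
  have hq0 : (Nat.card F : ℝ) ≠ 0 := by linarith
  have hu2 : u = algebraMap (KInf F) (CInf F) (algebraMap (RatFunc F) (KInf F)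
      (algebraMap F[X] (RatFunc F) (C c) / algebraMap F[X] (RatFunc F) X)) * ω +
      algebraMap (KInf F) (CInf F) (algebraMap (RatFunc F) (KInf F)
      (algebraMap F[X] (RatFunc F) (C α) / algebraMap F[X] (RatFunc F) X)) := by
    rw [← C_div_X_eq, ← C_div_X_eq, hu]
    ring
  have hn : ‖u‖ = (Nat.card F : ℝ) ^ ℓ * (Nat.card F : ℝ)⁻¹ := by
    rw [hu, norm_div, norm_polynomial_mul_add hω, norm_X_CInf,
      norm_polynomial (C_ne_zero.2 hc), natDegree_C, pow_zero, one_mul, max_eq_left, div_eq_mul_inv]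
    rw [norm_algebraMap_polynomial_le_iff, natDegree_C]
    exact Nat.zero_le _
  rw [expLattice_eq_setExp]
  -- The point has norm `q^(ℓ-1)`, which for `ℓ = 0` falls below 1 and into the other regime.
  rcases Nat.eq_zero_or_pos ℓ with h0 | h0
  · subst h0
    rw [pow_zero, one_mul] at hn
    rw [norm_setExp_of_norm_lt_one hω (norm_C_KInf_div_X_lt_one c)
      (norm_C_KInf_div_X_lt_one α) hu2, hn]
    · simp
    · rw [hn]
      exact inv_lt_one_of_one_lt₀ hq
  · obtain ⟨k, rfl⟩ : ∃ k, ℓ = k + 1 := ⟨ℓ - 1, by omega⟩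
    rw [pow_succ, mul_assoc, mul_inv_cancel₀ hq0, mul_one] at hn
    rw [norm_setExp_of_norm_eq_pow hω (norm_C_KInf_div_X_lt_one c)
      (norm_C_KInf_div_X_lt_one α) hu2 k.lt_succ_self hn, Finset.sum_range_succ', pow_zero, pow_succ,
      mul_assoc, mul_inv_cancel₀ hq0, mul_one]

theorem exists_expLattice_X_smul : ∃ g Δ : CInf F,
    (∀ z : CInf F, expLattice (latticeOf (stdLattice F 2) ![ω, 1]) ((X : F[X]) • z) =
      algebraMap F[X] (CInf F) X * expLattice (latticeOf (stdLattice F 2) ![ω, 1]) z +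
      g * expLattice (latticeOf (stdLattice F 2) ![ω, 1]) z ^ Nat.card F +
      Δ * (expLattice (latticeOf (stdLattice F 2) ![ω, 1]) z ^ Nat.card F) ^ Nat.card F) ∧
    ‖Δ‖ * (Nat.card F : ℝ) ^ (Nat.card F ^ (ℓ + 1)) =
      (Nat.card F : ℝ) ^ (Nat.card F ^ 2 + Nat.card F) := by
  set Λ := latticeOf (stdLattice F 2) ![ω, 1] with hΛ
  set t := algebraMap F[X] (CInf F) X with ht
  have ht0 : t ≠ 0 := X_CInf_ne_zero
  -- The chain `V = Λ ⊂ V₁ = Λ + F·T⁻¹ ⊂ V₂ = T⁻¹Λ`, each step adjoining one vector over `F`.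
  set V : Submodule F (CInf F) := Λ.restrictScalars F with hVdef
  set V₁ : Submodule F (CInf F) := V ⊔ Submodule.span F {1 / t} with hV₁def
  set V₂ : Submodule F (CInf F) := V.comap (LinearMap.mulLeft F t) with hV₂def
  have hcoe : ∀ α : F, algebraMap F (CInf F) α = algebraMap F[X] (CInf F) (C α) := fun _ => rfl
  have memV : ∀ x, x ∈ V ↔ ∃ a b : F[X],
      x = algebraMap F[X] (CInf F) a * ω + algebraMap F[X] (CInf F) b :=
    fun x => mem_latticeOf_stdLattice
  have memV₁ : ∀ x, x ∈ V₁ ↔ ∃ α : F, ∃ v ∈ V, x = α • (1 / t) + v := fun x => by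
    rw [hV₁def, Submodule.mem_sup]
    constructor
    · rintro ⟨v, hv, y, hy, rfl⟩
      obtain ⟨α, rfl⟩ := Submodule.mem_span_singleton.1 hy
      exact ⟨α, v, hv, add_comm _ _⟩
    · rintro ⟨α, v, hv, rfl⟩
      exact ⟨v, hv, _, Submodule.mem_span_singleton.2 ⟨α, rfl⟩, add_comm _ _⟩
  have memV₂ : ∀ x, x ∈ V₂ ↔ t * x ∈ V := fun x => Iff.rfl
  -- Dividing `aω + b` by `T` leaves the constant terms of `a` and `b` as coefficients of `ω/T` and
  -- `1/T`.
  have memV₂' : ∀ x, x ∈ V₂ ↔ ∃ α : F, ∃ v ∈ V₁, x = α • (ω / t) + v := fun x => by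
    rw [memV₂, memV]
    constructor
    · rintro ⟨a, b, h⟩
      refine ⟨a.coeff 0, b.coeff 0 • (1 / t) + (algebraMap F[X] (CInf F) a.divX * ω +
        algebraMap F[X] (CInf F) b.divX), (memV₁ _).2 ⟨_, _, (memV _).2 ⟨_, _, rfl⟩, rfl⟩, ?_⟩
      rw [Algebra.smul_def, Algebra.smul_def, hcoe, hcoe]
      refine mul_left_cancel₀ ht0 (h.trans ?_)
      conv_lhs => rw [← divX_mul_X_add a, ← divX_mul_X_add b]
      rw [map_add, map_add, map_mul, map_mul, ← ht]
      field_simp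
      ring
    · rintro ⟨α, v, hv, rfl⟩
      obtain ⟨β, v', hv', rfl⟩ := (memV₁ _).1 hv
      obtain ⟨a, b, rfl⟩ := (memV _).1 hv'
      refine ⟨X * a + C α, X * b + C β, ?_⟩
      rw [Algebra.smul_def, Algebra.smul_def, hcoe, hcoe, map_add, map_add, map_mul, map_mul, ← ht]
      field_simp
      ring
  have hVd : IsDiscreteSet (V : Set (CInf F)) := isDiscreteSet_lattice hω
  have hV₂d : IsDiscreteSet (V₂ : Set (CInf F)) := fun R => by
    refine ((hVd (‖t‖ * R)).preimage (f := fun x => t * x)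
      (mul_right_injective₀ ht0).injOn).subset fun x hx => ⟨hx.1, ?_⟩
    rw [norm_mul]
    exact mul_le_mul_of_nonneg_left hx.2 (norm_nonneg _)
  have hV₁d : IsDiscreteSet (V₁ : Set (CInf F)) :=
    hV₂d.mono fun x hx => (memV₂' x).2 ⟨0, x, hx, by simp⟩
  have hw₁ : 1 / t ∉ V := fun h => by
    obtain ⟨a, b, hab⟩ := (memV _).1 h
    have h2 := (polynomial_mul_add_eq_zero hω (a := X * a) (b := X * b - 1) (by
      rw [map_sub, map_mul, map_mul, map_one, ← ht, mul_assoc]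
      rw [div_eq_iff ht0] at hab
      linear_combination -hab)).2
    simpa using congrArg (eval 0) h2
  have hw₂ : ω / t ∉ V₁ := fun h => by
    obtain ⟨α, v, hv, h2⟩ := (memV₁ _).1 h
    obtain ⟨a, b, rfl⟩ := (memV _).1 hv
    have h2 := (polynomial_mul_add_eq_zero hω (a := X * a - 1) (b := X * b + C α) (by
      rw [map_sub, map_add, map_mul, map_mul, map_one, ← ht]
      rw [Algebra.smul_def, hcoe] at h2
      field_simp at h2
      linear_combination -h2)).1
    simpa using congrArg (eval 0) h2
  set y₁ := setExp (V : Set (CInf F)) (1 / t) with hy₁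
  set Y := setExp (V₁ : Set (CInf F)) (ω / t) with hY
  have hy₁0 : y₁ ≠ 0 := hVd.setExp_ne_zero V.zero_mem hw₁
  have hY0 : Y ≠ 0 := hV₁d.setExp_ne_zero V₁.zero_mem hw₂
  have hny₁ : ‖y₁‖ = (Nat.card F : ℝ)⁻¹ := norm_expLattice_one_div_X hω
  -- `Y` is `e^Λ(ω/T)` times the product over `α ≠ 0` of `1 - e^Λ(ω/T)/(α y₁)`. By linearity each
  -- factor equals `e^Λ((α - ω)/T)/(α y₁)`, of norm `(B/q)/(1/q) = B`; hence `‖Y‖ = B^q/q`.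
  have hnY : ‖Y‖ = ((Nat.card F : ℝ) ^ (∑ j ∈ Finset.range ℓ, Nat.card F ^ j)) ^ Nat.card F *
      (Nat.card F : ℝ)⁻¹ := by
    classical
    have := Fintype.ofFinite F
    have hq0 : (Nat.card F : ℝ) ≠ 0 := (zero_lt_one.trans one_lt_card_real).ne'
    have hq : Nat.card F = (Nat.card F - 1) + 1 := (Nat.sub_add_cancel Nat.card_pos).symm
    set B := (Nat.card F : ℝ) ^ (∑ j ∈ Finset.range ℓ, Nat.card F ^ j) with hB
    have h1 : ‖setExp (V : Set (CInf F)) (ω / t)‖ = B * (Nat.card F : ℝ)⁻¹ := by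
      have := norm_expLattice_div_X hω one_ne_zero 0
      rw [C_1, C_0, map_one, map_zero, one_mul, add_zero] at this
      exact this
    have h2 : ∀ α ∈ Finset.univ.erase (0 : F), ‖1 - setExp (V : Set (CInf F)) (ω / t) / y₁ /
        algebraMap F (CInf F) α‖ = B := fun α hα => by
      have hα0 := Finset.ne_of_mem_erase hα
      have hα1 : algebraMap F (CInf F) α ≠ 0 := by simpa using hα0
      have h3 := norm_expLattice_div_X hω (neg_ne_zero.2 one_ne_zero) α
      have h4 : (algebraMap F[X] (CInf F) (C (-1)) * ω + algebraMap F[X] (CInf F) (C α)) / t =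
          α • (1 / t) + (-1 : F) • (ω / t) := by
        rw [Algebra.smul_def, Algebra.smul_def, hcoe, hcoe]
        ring
      rw [h4, expLattice_eq_setExp] at h3
      change ‖setExp (V : Set (CInf F)) _‖ = _ at h3
      rw [hVd.setExp_add, hVd.setExp_smul, hVd.setExp_smul, ← hy₁] at h3
      have h5 : 1 - setExp (V : Set (CInf F)) (ω / t) / y₁ / algebraMap F (CInf F) α =
          (α • y₁ + (-1 : F) • setExp (V : Set (CInf F)) (ω / t)) /
            (algebraMap F (CInf F) α * y₁) := by
        rw [neg_one_smul, Algebra.smul_def]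
        field_simp
        ring
      rw [h5, norm_div, h3, norm_mul, norm_algebraMap_of_finite hα0, hny₁, one_mul,
        mul_div_assoc, div_self (inv_ne_zero hq0), mul_one]
    have h6 : Y = setExp (V : Set (CInf F)) (ω / t) * ∏ α ∈ Finset.univ.erase (0 : F),
        (1 - setExp (V : Set (CInf F)) (ω / t) / y₁ / algebraMap F (CInf F) α) := by
      rw [prod_one_sub_div_algebraMap, hY, hVd.setExp_adjoin hV₁d hw₁ memV₁, ← hy₁, div_pow,
        ← Nat.card_eq_fintype_card]
      nth_rewrite 1 [hq]
      rw [pow_succ]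
      ring
    rw [h6, norm_mul, norm_prod, Finset.prod_congr rfl h2, Finset.prod_const, h1,
      Finset.card_erase_of_mem (Finset.mem_univ _), Finset.card_univ, ← Nat.card_eq_fintype_card]
    conv_rhs => rw [hq, pow_succ]
    rw [Nat.sub_add_cancel Nat.card_pos]
    ring
  -- The coefficients obtained by substituting `E = e - e^q/y₁^(q-1)` into `t(E - E^q/Y^(q-1))`.
  refine ⟨-t / y₁ ^ (Nat.card F - 1) - t / Y ^ (Nat.card F - 1),
    t / (Y ^ (Nat.card F - 1) * (y₁ ^ (Nat.card F - 1)) ^ Nat.card F), fun z => ?_, ?_⟩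
  · have h1 : expLattice Λ ((X : F[X]) • z) = t * setExp (V₂ : Set (CInf F)) z := by
      rw [Algebra.smul_def]
      exact setExp_smul_set ht0 (fun x => (memV₂ x).symm) z
    rw [h1, hV₁d.setExp_adjoin hV₂d hw₂ memV₂', ← hY, hVd.setExp_adjoin hV₁d hw₁ memV₁, ← hy₁,
      sub_pow_card, div_pow]
    change _ = t * setExp (V : Set (CInf F)) z + _ * setExp (V : Set (CInf F)) z ^ _ +
      _ * (setExp (V : Set (CInf F)) z ^ _) ^ _
    field_simp
    ring
  · have hq : Nat.card F = (Nat.card F - 1) + 1 := (Nat.sub_add_cancel Nat.card_pos).symm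
    have h := mul_pow_eq_of_norm_relation (m := Nat.card F - 1) (ℓ := ℓ) (Q := Nat.card F)
      (B := (Nat.card F : ℝ) ^ (∑ j ∈ Finset.range ℓ, Nat.card F ^ j))
      (D := ‖t / (Y ^ (Nat.card F - 1) * (y₁ ^ (Nat.card F - 1)) ^ Nat.card F)‖)
      (zero_lt_one.trans one_lt_card_real)
    rw [← hq] at h
    refine h ?_ ?_
    · rw [← pow_mul, ← pow_succ, mul_comm, card_sub_one_mul_sum_pow]
    · rw [norm_div, norm_mul, norm_pow, norm_pow, norm_pow, ← hnY, ← hny₁, norm_X_CInf]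
      exact div_mul_cancel₀ _ (mul_ne_zero (pow_ne_zero _ (norm_ne_zero_iff.2 hY0))
        (pow_ne_zero _ (pow_ne_zero _ (norm_ne_zero_iff.2 hy₁0))))

/-- The exponential preserves the norms of the points `T^(-k-1)`, which are pairwise distinct.
Infinitely many values are needed so that the functional equation determines `φ_a`. -/
theorem infinite_range_expLattice :
    (Set.range (expLattice (latticeOf (stdLattice F 2) ![ω, 1]))).Infinite := by
  have hq := one_lt_card_real (F := F)
  have hn : ∀ k : ℕ, ‖(algebraMap F[X] (CInf F) X)⁻¹ ^ (k + 1)‖ = (Nat.card F : ℝ)⁻¹ ^ (k + 1) :=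
    fun k => by rw [norm_pow, norm_inv, norm_X_CInf]
  have hlt : ∀ k : ℕ, (Nat.card F : ℝ)⁻¹ ^ (k + 1) < 1 := fun k =>
    pow_lt_one₀ (by positivity) (inv_lt_one_of_one_lt₀ hq) (Nat.succ_ne_zero k)
  have hy : ∀ k : ℕ, algebraMap (KInf F) (CInf F) ((algebraMap (RatFunc F) (KInf F)
      (algebraMap F[X] (RatFunc F) X))⁻¹ ^ (k + 1)) =
      (algebraMap F[X] (CInf F) X)⁻¹ ^ (k + 1) := fun k => by
    rw [map_pow, map_inv₀]
    rfl
  have he : ∀ k : ℕ, ‖expLattice (latticeOf (stdLattice F 2) ![ω, 1])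
      ((algebraMap F[X] (CInf F) X)⁻¹ ^ (k + 1))‖ = (Nat.card F : ℝ)⁻¹ ^ (k + 1) := fun k => by
    rw [← hn, expLattice_eq_setExp]
    refine norm_setExp_of_norm_lt_one hω (x := 0) (by simp)
      (y := (algebraMap (RatFunc F) (KInf F) (algebraMap F[X] (RatFunc F) X))⁻¹ ^ (k + 1)) ?_
      (by rw [← hy, map_zero, zero_mul, zero_add]) ((hn k).trans_lt (hlt k))
    rw [← norm_algebraMap_KInf, hy, hn]
    exact hlt k
  refine (Set.infinite_range_of_injective (f := fun k : ℕ =>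
    expLattice (latticeOf (stdLattice F 2) ![ω, 1])
      ((algebraMap F[X] (CInf F) X)⁻¹ ^ (k + 1))) fun i j hij => ?_).mono ?_
  · have h := congrArg norm hij
    simp only [he] at h
    have := pow_right_injective₀ (inv_pos.2 (zero_lt_one.trans hq))
      (inv_lt_one_of_one_lt₀ hq).ne h
    omega
  · rintro _ ⟨k, rfl⟩
    exact ⟨_, rfl⟩

/-- For `a = T` the exponent `(q² - 1)/(q² - 1)` is 1 and the sign is 1, so `Δ` is itself a
coefficient of the unique `φ_T`. -/
theorem IsCanonicalDiscriminant.unique {Δ Δ' : CInf F}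
    (h : IsCanonicalDiscriminant (latticeOf (stdLattice F 2) ![ω, 1]) Δ)
    (h' : IsCanonicalDiscriminant (latticeOf (stdLattice F 2) ![ω, 1]) Δ') : Δ = Δ' := by
  obtain ⟨φ, hφ, hc⟩ := h X X_ne_zero
  obtain ⟨φ', hφ', hc'⟩ := h' X X_ne_zero
  have heq : φ = φ' := eq_of_infinite_eval_eq _ _
    ((infinite_range_expLattice hω).mono (by
      rintro _ ⟨z, rfl⟩
      exact (hφ.exp_smul z).symm.trans (hφ'.exp_smul z)))
  have h2 : 1 < Nat.card F ^ 2 := Nat.one_lt_pow two_ne_zero Finite.one_lt_card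
  rw [finrank_lattice hω, natDegree_X, mul_one, Nat.div_self (by omega), pow_one, leadingCoeff_X,
    C_1, map_one, one_mul] at hc hc'
  rw [← hc, ← hc', heq]

theorem exists_isCanonicalDiscriminant : ∃ Δ : CInf F,
    IsCanonicalDiscriminant (latticeOf (stdLattice F 2) ![ω, 1]) Δ ∧
    logq Δ = (((Nat.card F : ℝ) ^ 2 + Nat.card F - (Nat.card F : ℝ) ^ (ℓ + 1) : ℝ) : EReal) := by
  obtain ⟨g, Δ, hT, hΔ⟩ := exists_expLattice_X_smul hω
  have hq := one_lt_card_real (F := F)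
  have hq0 : 0 < (Nat.card F : ℝ) := zero_lt_one.trans hq
  have hΔ0 : ‖Δ‖ ≠ 0 := fun h => by
    rw [h, zero_mul] at hΔ
    exact (pow_pos hq0 _).ne hΔ
  refine ⟨Δ, isCanonicalDiscriminant_of_exp_X_smul (finrank_lattice hω) (expLattice_add hω)
    (expLattice_smul hω) hT, ?_⟩
  rw [logq, if_neg (norm_ne_zero_iff.1 hΔ0), EReal.coe_eq_coe_iff]
  have h := congrArg (Real.logb (Nat.card F)) hΔ
  rw [Real.logb_mul hΔ0 (pow_pos hq0 _).ne', Real.logb_pow, Real.logb_pow,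
    Real.logb_self_eq_one hq] at h
  push_cast at h
  linarith

end CanonicalDiscriminant

/-! ### Translation to logarithms. -/

section DivisionFormLog

variable {F : Type*} [Field F] [Finite F]

theorem logq_congr {x y : CInf F} (h : ‖x‖ = ‖y‖) : logq x = logq y := by
  have h0 : x = 0 ↔ y = 0 := by rw [← norm_eq_zero, h, norm_eq_zero]
  by_cases hy : y = 0
  · simp [logq, h0.2 hy, hy]
  · simp [logq, hy, mt h0.1 hy, h]

theorem logq_nonneg_iff {x : CInf F} : 0 ≤ logq x ↔ 1 ≤ ‖x‖ := by
  have hq := one_lt_card_real (F := F)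
  rw [logq]
  split_ifs with h
  · simp [h]
  · rw [EReal.coe_nonneg, Real.logb_nonneg_iff hq (norm_pos_iff.2 h)]

theorem sum_pow_succ_eq (k : ℕ) : ((∑ j ∈ Finset.range k, Nat.card F ^ (j + 1) : ℕ) : ℝ) =
    (Nat.card F : ℝ) / (Nat.card F - 1) * ((Nat.card F : ℝ) ^ k - 1) := by
  have hq := one_lt_card_real (F := F)
  have h1 := geom_sum_eq hq.ne' k
  push_cast
  simp only [pow_succ]
  rw [← Finset.sum_mul, h1]
  ring

theorem norm_div_lt_one {a n : F[X]} (h : a.degree < n.degree) :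
    ‖algebraMap (RatFunc F) (KInf F)
      (algebraMap F[X] (RatFunc F) a / algebraMap F[X] (RatFunc F) n)‖ < 1 := by
  have hq := one_lt_card_real (F := F)
  have hn : n ≠ 0 := ne_zero_of_degree_gt h
  rcases eq_or_ne a 0 with rfl | ha
  · simp
  · rw [map_div₀, norm_div, norm_polynomial_KInf ha, norm_polynomial_KInf hn,
      div_lt_one (pow_pos (zero_lt_one.trans hq) _)]
    exact pow_lt_pow_right₀ hq (natDegree_lt_natDegree ha h)

end DivisionFormLog

end DrinfeldFT

end

/-! ### The main theorem. -/

open DrinfeldFT in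
theorem mainTheorem11 {F : Type*} [Field F] [Finite F] (ℓ : ℕ) (ω : CInf F)
    (hω : ω ∈ fundDomainPart F ℓ) :
    (∀ z : CInf F, Multipliable fun l : {l : CInf F //
        l ∈ latticeOf (stdLattice F 2) ![ω, 1] ∧ l ≠ 0} => 1 - z / (l : CInf F)) ∧
    (∃! Δ : CInf F, IsCanonicalDiscriminant (latticeOf (stdLattice F 2) ![ω, 1]) Δ) ∧
    (∀ Δ : CInf F, IsCanonicalDiscriminant (latticeOf (stdLattice F 2) ![ω, 1]) Δ →
      logq Δ = (((Nat.card F : ℝ) ^ 2 + Nat.card F - (Nat.card F : ℝ) ^ (ℓ + 1) : ℝ) : EReal)) ∧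
    ∀ (n a₁ a₂ : F[X]) (u : Fin 2 → RatFunc F), a₁.degree < n.degree → a₂.degree < n.degree →
      u = ![algebraMap F[X] (RatFunc F) a₁ / algebraMap F[X] (RatFunc F) n,
        algebraMap F[X] (RatFunc F) a₂ / algebraMap F[X] (RatFunc F) n] →
      u ≠ 0 →
      (0 ≤ logq (embed ![ω, 1] u) →
        logq (divisionForm (stdLattice F 2) u ![ω, 1]) =
          (((Nat.card F : ℝ) / (Nat.card F - 1) *
            ((Nat.card F : ℝ) ^ ((ℓ : ℤ) + a₁.natDegree - n.natDegree) - 1) : ℝ) : EReal)) ∧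
      (logq (embed ![ω, 1] u) < 0 →
        logq (divisionForm (stdLattice F 2) u ![ω, 1]) = logq (embed ![ω, 1] u)) := by
  obtain ⟨Δ, hΔ, hlog⟩ := exists_isCanonicalDiscriminant hω
  refine ⟨fun z => (isDiscreteSet_lattice hω).multipliable z,
    ⟨Δ, hΔ, fun Δ' h' => h'.unique hω hΔ⟩, fun Δ' h' => by rw [h'.unique hω hΔ, hlog], ?_⟩
  intro n a₁ a₂ u h₁ h₂ hu hu0
  have hq := one_lt_card_real (F := F)
  have hq0 : 0 < (Nat.card F : ℝ) := zero_lt_one.trans hq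
  have hn : n ≠ 0 := ne_zero_of_degree_gt h₁
  have hx := norm_div_lt_one h₁
  have hy := norm_div_lt_one h₂
  have hu2 : embed ![ω, 1] u = algebraMap (KInf F) (CInf F) (algebraMap (RatFunc F) (KInf F)
      (algebraMap F[X] (RatFunc F) a₁ / algebraMap F[X] (RatFunc F) n)) * ω +
      algebraMap (KInf F) (CInf F) (algebraMap (RatFunc F) (KInf F)
      (algebraMap F[X] (RatFunc F) a₂ / algebraMap F[X] (RatFunc F) n)) := by
    rw [embed_pair, hu]
    rfl
  constructor
  · intro hge
    rw [logq_nonneg_iff] at hge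
    have hmax := norm_mul_add_eq_max hω (algebraMap (RatFunc F) (KInf F)
      (algebraMap F[X] (RatFunc F) a₁ / algebraMap F[X] (RatFunc F) n))
      (algebraMap (RatFunc F) (KInf F)
      (algebraMap F[X] (RatFunc F) a₂ / algebraMap F[X] (RatFunc F) n))
    rw [← hu2] at hmax
    have hnorm : ‖embed ![ω, 1] u‖ = ‖algebraMap (RatFunc F) (KInf F)
      (algebraMap F[X] (RatFunc F) a₁ / algebraMap F[X] (RatFunc F) n)‖ *
        (Nat.card F : ℝ) ^ ℓ := by
      rcases max_choice (‖algebraMap (RatFunc F) (KInf F)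
        (algebraMap F[X] (RatFunc F) a₁ / algebraMap F[X] (RatFunc F) n)‖ *
          (Nat.card F : ℝ) ^ ℓ) ‖algebraMap (RatFunc F) (KInf F)
        (algebraMap F[X] (RatFunc F) a₂ / algebraMap F[X] (RatFunc F) n)‖ with h | h
      · rw [hmax, h]
      · rw [hmax, h] at hge
        linarith
    have ha₁ : a₁ ≠ 0 := by
      rintro rfl
      rw [hnorm, map_zero, zero_div, map_zero, norm_zero, zero_mul] at hge
      linarith
    have hd := natDegree_lt_natDegree ha₁ h₁
    have hz : ‖embed ![ω, 1] u‖ =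
        (Nat.card F : ℝ) ^ ((ℓ : ℤ) + a₁.natDegree - n.natDegree) := by
      rw [hnorm, map_div₀, norm_div, norm_polynomial_KInf ha₁, norm_polynomial_KInf hn,
        zpow_sub₀ hq0.ne', zpow_add₀ hq0.ne', zpow_natCast, zpow_natCast, zpow_natCast]
      ring
    have hk0 : 0 ≤ (ℓ : ℤ) + a₁.natDegree - n.natDegree := by
      rw [hz] at hge
      exact (one_le_zpow_iff_right₀ hq).1 hge
    obtain ⟨k, hk⟩ := Int.eq_ofNat_of_zero_le hk0
    rw [hk, zpow_natCast] at hz ⊢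
    -- Here `k = ℓ + d₁ - deg n`, and `k < ℓ` because `d₁ < deg n`.
    have he := norm_setExp_of_norm_eq_pow hω hx hy hu2 (k := k) (by omega) hz
    change ‖divisionForm (stdLattice F 2) u ![ω, 1]‖ = _ at he
    rw [logq, if_neg, he, Real.logb_pow, Real.logb_self_eq_one hq, mul_one, sum_pow_succ_eq]
    refine norm_ne_zero_iff.1 ?_
    rw [he]
    exact (pow_pos hq0 _).ne'
  · intro hlt
    rw [← not_le, logq_nonneg_iff, not_le] at hlt
    exact logq_congr (norm_setExp_of_norm_lt_one hω hx hy hu2 hlt)
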